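/- For each $m\ge 1$ let $M_m$ and $P_m$ be random $m\times m$ matrices with complex entries, all defined on a common probability space (no independence of any kind is assumed), and let $f(z,m)\ge 1$ be a real-valued function of $z\in\mathbb C$ and $m$. Write $\|A\|_F=\operatorname{tr}(AA^*)^{1/2}$ for the Frobenius norm, $\|A\|$ for the operator norm with respect to the Euclidean norm on $\mathbb C^m$, and $\mu_A=\frac1m\sum_{i=1}^m\delta_{\lambda_i}$ for the empirical spectral measure of an $m\times m$ matrix $A$ with eigenvalues $\lambda_1,\dots,\lambda_m$ (with algebraic multiplicity). Assume that 1. $X_m:=\frac1m\|M_m\|_F^2+\frac1m\|M_m+P_m\|_F^2$ is bounded in probability, i.e. $\lim_{C\to\infty}\liminf_{m\to\infty}\Pr(|X_m|\le C)=1$ (resp. almost surely bounded, i.e. $\Pr(\limsup_{m\to\infty}|X_m|<\infty)=1$); 2. for almost every $z\in\mathbb C$ (with respect to Lebesgue measure), $f(z,m)\|P_m\|$ converges to zero in probability (resp. almost surely) as $m\to\infty$; 3. for almost every $z\in\mathbb C$, with probability tending to $1$ as $m\to\infty$ (resp. almost surely for all but finitely many $m$), the matrix $M_m-zI$ is invertible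 and $\|(M_m-zI)^{-1}\|\le f(z,m)$. Then $\mu_{M_m}-\mu_{M_m+P_m}$ converges to zero in probability (resp. almost surely): for every bounded continuous function $\varphi:\mathbb C\to\mathbb R$, $\int\varphi\,d\mu_{M_m}-\int\varphi\,d\mu_{M_m+P_m}\to 0$ in probability (resp. almost surely) as $m\to\infty$. -/

import Mathlib

open MeasureTheory Filter Topology
open scoped Matrix ENNReal BoundedContinuousFunction

namespace ReplacementPrinciple

noncomputable section

/-- The Frobenius (Hilbert–Schmidt) norm `tr(A A*)^{1/2}`. -/
def frobeniusNorm {m : ℕ} (A : Matrix (Fin m) (Fin m) ℂ) : ℝ :=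
  Real.sqrt (A * Aᴴ).trace.re

/-- The operator norm with respect to the Euclidean norm on `ℂ^m`. -/
def opNorm {m : ℕ} (A : Matrix (Fin m) (Fin m) ℂ) : ℝ :=
  ‖Matrix.toEuclideanCLM (n := Fin m) (𝕜 := ℂ) A‖

/-- The empirical spectral measure `(1/m) ∑ δ_{λ_i}`, where the eigenvalues `λ_i` are the roots of
the characteristic polynomial, listed with (algebraic) multiplicity. -/
def esm {m : ℕ} (A : Matrix (Fin m) (Fin m) ℂ) : Measure ℂ :=
  (m : ℝ≥0∞)⁻¹ • (A.charpoly.roots.map Measure.dirac).sum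

variable {Ω : Type*} [MeasurableSpace Ω]

/-- `lim_{C → ∞} liminf_{n → ∞} Pr(|X_n| ≤ C) = 1`. -/
def BoundedInProbability (Pr : Measure Ω) (X : ℕ → Ω → ℝ) : Prop :=
  Tendsto (fun C : ℝ => liminf (fun n => Pr {ω | |X n ω| ≤ C}) atTop) atTop (𝓝 1)

/-- `Pr(limsup_{n → ∞} |X_n| < ∞) = 1`, the limsup being taken in `[0, ∞]`. -/
def AlmostSurelyBounded (Pr : Measure Ω) (X : ℕ → Ω → ℝ) : Prop :=
  ∀ᵐ ω ∂Pr, limsup (fun n => ENNReal.ofReal |X n ω|) atTop < ∞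

/-- `μ_n - ν_n` converges (weakly) to zero in probability, for random measures `μ_n`, `ν_n`. -/
def DiffTendstoZeroInProbability (Pr : Measure Ω) (μ ν : ℕ → Ω → Measure ℂ) : Prop :=
  ∀ φ : ℂ →ᵇ ℝ, TendstoInMeasure Pr
    (fun n ω => (∫ w, φ w ∂(μ n ω)) - ∫ w, φ w ∂(ν n ω)) atTop (fun _ => 0)

/-- `μ_n - ν_n` converges (weakly) to zero almost surely, for random measures `μ_n`, `ν_n`. -/
def DiffTendstoZeroAlmostSurely (Pr : Measure Ω) (μ ν : ℕ → Ω → Measure ℂ) : Prop :=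
  ∀ φ : ℂ →ᵇ ℝ, ∀ᵐ ω ∂Pr,
    Tendsto (fun n => (∫ w, φ w ∂(μ n ω)) - ∫ w, φ w ∂(ν n ω)) atTop (𝓝 0)

/-- `A - zI` is invertible and `‖(A - zI)⁻¹‖ ≤ c`. -/
def ResolventBound {m : ℕ} (A : Matrix (Fin m) (Fin m) ℂ) (z : ℂ) (c : ℝ) : Prop :=
  IsUnit (A - z • (1 : Matrix (Fin m) (Fin m) ℂ)) ∧
    opNorm (A - z • (1 : Matrix (Fin m) (Fin m) ℂ))⁻¹ ≤ c

end

end ReplacementPrinciple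

namespace ReplacementPrinciple

/-! ### Local integrability of the logarithm on `ℂ` -/

/-! Everything passes through the logarithmic potential: away from the eigenvalues, `(1/m) log |det
(A - z)|` is the integral of `log |z - λ|` against the spectral measure of `A`. It suffices that the
potentials of `M` and `M + P` are close for most `z`, and that close potentials force close
measures.

For the first point, write `M + P - z = (M - z)(1 + E)` with `E = (M - z)⁻¹ P`. The hypotheses make
the operator norm of `E` small, so all eigenvalues of `1 + E` are near `1`, and `(1/m) log |det (1 +
E)|` is `O(‖E‖)` uniformly in `m` (`abs_logDetDiff_add_le`).

For the second, a continuous compactly supported `φ` is uniformly close to the potential of a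
bounded density `H` on a disc (`exists_potential_approx`), so averages of `φ` over eigenvalues
become integrals of `H` against potentials. No derivatives are taken: the disc average of the
logarithm minus the logarithm itself is, off the origin, a nonnegative radial kernel supported in a
disc. Convolving `φ` with this kernel, once normalized, approximates `φ`, and by Fubini the
averaging can be moved from the logarithm onto `φ`.

The Frobenius bound enters through Schur's inequality (`sum_norm_sq_roots_charpoly_le`), which
bounds the second moments of the eigenvalues. This bounds the potentials in `L²` on discs, so an
exceptional set of `z` of small area is harmless, and it provides the tightness needed for merely
bounded `φ`. Fubini converts information for almost every fixed `z` into information about most `z`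
for a given `ω`. -/

lemma mul_log_sq_le_four {s : ℝ} (h0 : 0 < s) (h1 : s ≤ 1) : s * Real.log s ^ 2 ≤ 4 := by
  have h := (Real.abs_log_mul_self_rpow_lt s (1 / 2) h0 h1 (by norm_num)).le
  have h2 : (Real.log s * s ^ (1 / 2 : ℝ)) ^ 2 ≤ 2 ^ 2 := by
    rw [← sq_abs]
    gcongr
    simpa using h
  rw [mul_pow, ← Real.sqrt_eq_rpow, Real.sq_sqrt h0.le] at h2
  linarith

lemma measurable_log_norm_sub (w : ℂ) : Measurable fun z : ℂ => Real.log ‖z - w‖ := by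
  fun_prop

/-- In polar coordinates the Jacobian `s` absorbs the singularity of `log² s`, leaving a bounded
integrand on a bounded rectangle. -/
lemma integrableOn_log_sq_unit_ball :
    IntegrableOn (fun z : ℂ => Real.log ‖z‖ ^ 2) (Metric.ball 0 1) := by
  refine ⟨Measurable.aestronglyMeasurable (by fun_prop), ?_⟩
  rw [HasFiniteIntegral, ← lintegral_indicator Metric.isOpen_ball.measurableSet,
    ← Complex.lintegral_comp_polarCoord_symm, polarCoord_target]
  calc _ ≤ ∫⁻ p in Set.Ioi 0 ×ˢ Set.Ioo (-Real.pi) Real.pi,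
        (Set.Ioo (0 : ℝ) 1 ×ˢ Set.Ioo (-Real.pi) Real.pi).indicator (fun _ => (4 : ℝ≥0∞)) p := by
        refine setLIntegral_mono' (measurableSet_Ioi.prod measurableSet_Ioo) fun p hp => ?_
        obtain ⟨h0, h1⟩ := hp
        have h0 : 0 < p.1 := h0
        by_cases hlt : p.1 < 1
        · rw [Set.indicator_of_mem (by simpa [Complex.norm_polarCoord_symm, abs_of_pos h0] using hlt),
            Set.indicator_of_mem (by exact ⟨⟨h0, hlt⟩, h1⟩), Complex.norm_polarCoord_symm,
            abs_of_pos h0, smul_eq_mul, Real.enorm_eq_ofReal (by positivity),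
            ← ENNReal.ofReal_mul h0.le]
          calc _ ≤ ENNReal.ofReal 4 := ENNReal.ofReal_le_ofReal (mul_log_sq_le_four h0 hlt.le)
            _ = 4 := by simp
        · rw [Set.indicator_of_notMem
            (by simpa [Complex.norm_polarCoord_symm, abs_of_pos h0] using hlt)]
          simp
    _ ≤ ∫⁻ p, (Set.Ioo (0 : ℝ) 1 ×ˢ Set.Ioo (-Real.pi) Real.pi).indicator
          (fun _ => (4 : ℝ≥0∞)) p := setLIntegral_le_lintegral _ _
    _ < ∞ := by
        rw [lintegral_indicator (measurableSet_Ioo.prod measurableSet_Ioo), lintegral_const]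
        simp only [Measure.restrict_apply_univ, Measure.volume_eq_prod, Measure.prod_prod,
          Real.volume_Ioo]
        exact ENNReal.mul_lt_top (by simp) (ENNReal.mul_lt_top (by simp) (by simp))

/-- The square of `log ‖z - w‖` is integrable over a disc, with a bound quadratic in `w`. -/
lemma exists_integral_log_sq_le (R : ℝ) : ∃ K : ℝ, 0 ≤ K ∧ ∀ w : ℂ,
    IntegrableOn (fun z => Real.log ‖z - w‖ ^ 2) (Metric.ball 0 R) ∧
    ∫ z in Metric.ball 0 R, Real.log ‖z - w‖ ^ 2 ≤ K * (1 + ‖w‖ ^ 2) := by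
  set g : ℂ → ℝ := (Metric.ball (0 : ℂ) 1).indicator fun z => Real.log ‖z‖ ^ 2 with hg
  have hgi : Integrable g :=
    (integrable_indicator_iff Metric.isOpen_ball.measurableSet).2 integrableOn_log_sq_unit_ball
  have hg0 : ∀ z, 0 ≤ g z := fun z => Set.indicator_nonneg (fun _ _ => by positivity) z
  set V : ℝ := volume.real (Metric.ball (0 : ℂ) R)
  have hfin : volume (Metric.ball (0 : ℂ) R) ≠ ∞ := measure_ball_lt_top.ne
  have hV : 0 ≤ V := measureReal_nonneg
  have hI : 0 ≤ ∫ z, g z := integral_nonneg hg0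
  refine ⟨(∫ z, g z) + V * (2 * R ^ 2 + 2), by positivity, fun w => ?_⟩
  -- Near `w` the singularity is a translate of `g`, whose integral does not depend on `w`; at
  -- distance at least `1` the logarithm lies between `0` and `‖z - w‖ ≤ R + ‖w‖`.
  have hbound : ∀ z ∈ Metric.ball (0 : ℂ) R,
      Real.log ‖z - w‖ ^ 2 ≤ g (z - w) + (2 * R ^ 2 + 2 * ‖w‖ ^ 2) := by
    intro z hz
    have hz' : ‖z‖ < R := by simpa using hz
    by_cases h : ‖z - w‖ < 1
    · rw [hg, Set.indicator_of_mem (by simpa using h)]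
      nlinarith [sq_nonneg R, sq_nonneg ‖w‖]
    · push Not at h
      have h1 : Real.log ‖z - w‖ ≤ ‖z - w‖ := Real.log_le_self (by positivity)
      have h2 : 0 ≤ Real.log ‖z - w‖ := Real.log_nonneg h
      have h3 : ‖z - w‖ ≤ R + ‖w‖ := (norm_sub_le z w).trans (by linarith)
      have h4 : Real.log ‖z - w‖ ^ 2 ≤ (R + ‖w‖) ^ 2 :=
        pow_le_pow_left₀ h2 (h1.trans h3) 2
      nlinarith [hg0 (z - w), sq_nonneg (R - ‖w‖)]
  have hi1 : IntegrableOn (fun z => g (z - w)) (Metric.ball 0 R) :=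
    (hgi.comp_sub_right w).integrableOn
  have hi2 : IntegrableOn (fun z => g (z - w) + (2 * R ^ 2 + 2 * ‖w‖ ^ 2)) (Metric.ball 0 R) :=
    hi1.add (integrableOn_const hfin)
  have hi : IntegrableOn (fun z => Real.log ‖z - w‖ ^ 2) (Metric.ball 0 R) := by
    refine Integrable.mono' hi2 (Measurable.aestronglyMeasurable (by fun_prop)) ?_
    refine (ae_restrict_iff' Metric.isOpen_ball.measurableSet).2 (ae_of_all _ fun z hz => ?_)
    rw [Real.norm_of_nonneg (by positivity)]
    exact hbound z hz
  refine ⟨hi, (setIntegral_mono_on hi hi2 Metric.isOpen_ball.measurableSet hbound).trans ?_⟩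
  rw [integral_add hi1 (integrableOn_const hfin), setIntegral_const, smul_eq_mul]
  have h5 : ∫ z in Metric.ball 0 R, g (z - w) ≤ ∫ z, g z := by
    rw [← integral_sub_right_eq_self g w]
    exact setIntegral_le_integral (hgi.comp_sub_right w) (ae_of_all _ fun z => hg0 _)
  change _ + V * _ ≤ _
  nlinarith [mul_nonneg hI (sq_nonneg ‖w‖), mul_nonneg hV (mul_nonneg (sq_nonneg R) (sq_nonneg ‖w‖))]

lemma integrableOn_log_norm_sub (w : ℂ) (R : ℝ) :
    IntegrableOn (fun z => Real.log ‖z - w‖) (Metric.ball 0 R) := by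
  obtain ⟨K, -, hK⟩ := exists_integral_log_sq_le R
  refine Integrable.mono' ((hK w).1.add (integrableOn_const (C := (1 : ℝ)) measure_ball_lt_top.ne))
    (measurable_log_norm_sub w).aestronglyMeasurable (ae_of_all _ fun z => ?_)
  rw [Real.norm_eq_abs]
  simp only [Pi.add_apply]
  nlinarith [sq_abs (Real.log ‖z - w‖), sq_nonneg (|Real.log ‖z - w‖| - 1 / 2)]

/-! ### Averages of the logarithm over discs -/

lemma integral_Ioo_polarCoord_symm (f : ℂ → ℝ) (s : ℝ) :
    ∫ θ in Set.Ioo (-Real.pi) Real.pi, f (Complex.polarCoord.symm (s, θ))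
      = 2 * Real.pi * Real.circleAverage f 0 s := by
  have hper : Function.Periodic (fun θ => f (circleMap 0 s θ)) (2 * Real.pi) := fun θ => by
    simp only [periodic_circleMap 0 s θ]
  have h := hper.intervalIntegral_add_eq (-Real.pi) 0
  rw [Real.circleAverage_def, smul_eq_mul, mul_inv_cancel_left₀ (by positivity)]
  rw [show -Real.pi + 2 * Real.pi = Real.pi by ring, zero_add] at h
  rw [← h, intervalIntegral.integral_of_le (by linarith [Real.pi_pos]),
    ← integral_Ioc_eq_integral_Ioo]
  refine integral_congr_ae (ae_of_all _ fun θ => ?_)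
  simp [circleMap, Complex.exp_mul_I]

/-- Polar coordinates: the integral over a disc, in terms of circle averages. -/
lemma integral_ball_eq_integral_circleAverage (f : ℂ → ℝ) {ρ : ℝ}
    (hf : IntegrableOn f (Metric.ball 0 ρ)) (hm : Measurable f) :
    IntegrableOn (fun s => s * (2 * Real.pi * Real.circleAverage f 0 s)) (Set.Ioo 0 ρ) ∧
    ∫ z in Metric.ball 0 ρ, f z
      = ∫ s in Set.Ioo 0 ρ, s * (2 * Real.pi * Real.circleAverage f 0 s) := by
  set F : ℝ × ℝ → ℝ := fun p =>
    p.1 • (Metric.ball (0 : ℂ) ρ).indicator f (Complex.polarCoord.symm p) with hF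
  have hmp : Measurable fun p : ℝ × ℝ => Complex.polarCoord.symm p := by
    simp only [Complex.polarCoord_symm_apply]
    fun_prop
  have hFm : Measurable F :=
    measurable_fst.smul ((hm.indicator Metric.isOpen_ball.measurableSet).comp hmp)
  have hFi : IntegrableOn F polarCoord.target := by
    refine ⟨hFm.aestronglyMeasurable, ?_⟩
    have h1 := ((integrable_indicator_iff Metric.isOpen_ball.measurableSet).2 hf).2
    rw [HasFiniteIntegral, ← Complex.lintegral_comp_polarCoord_symm] at h1
    rw [HasFiniteIntegral]
    refine lt_of_le_of_lt (le_of_eq ?_) h1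
    refine setLIntegral_congr_fun polarCoord.open_target.measurableSet fun p hp => ?_
    have hp0 : 0 < p.1 := hp.1
    simp only [hF, smul_eq_mul]
    rw [enorm_mul, Real.enorm_eq_ofReal hp0.le]
  rw [polarCoord_target, IntegrableOn, Measure.volume_eq_prod, ← Measure.prod_restrict] at hFi
  have hinner : ∀ s ∈ Set.Ioi (0 : ℝ), ∫ θ in Set.Ioo (-Real.pi) Real.pi, F (s, θ)
      = (Set.Ioo 0 ρ).indicator (fun s => s * (2 * Real.pi * Real.circleAverage f 0 s)) s := by
    intro s hs
    have hs : 0 < s := hs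
    by_cases h : s < ρ
    · rw [Set.indicator_of_mem (by exact ⟨hs, h⟩), ← integral_Ioo_polarCoord_symm,
        ← integral_const_mul]
      refine integral_congr_ae (ae_of_all _ fun θ => ?_)
      simp only [hF]
      rw [Set.indicator_of_mem (by simpa [Complex.norm_polarCoord_symm, abs_of_pos hs] using h),
        smul_eq_mul]
    · rw [Set.indicator_of_notMem (by simp [h])]
      refine (integral_congr_ae (ae_of_all _ fun θ => ?_)).trans (integral_zero _ _)
      simp only [hF]
      rw [Set.indicator_of_notMem (by simpa [Complex.norm_polarCoord_symm, abs_of_pos hs] using h),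
        smul_zero]
  have hae : (fun s => ∫ θ in Set.Ioo (-Real.pi) Real.pi, F (s, θ))
      =ᵐ[volume.restrict (Set.Ioi 0)]
        (Set.Ioo 0 ρ).indicator (fun s => s * (2 * Real.pi * Real.circleAverage f 0 s)) :=
    (ae_restrict_iff' measurableSet_Ioi).2 (ae_of_all _ hinner)
  have hsub : Set.Ioo 0 ρ ⊆ Set.Ioi 0 := fun _ h => h.1
  constructor
  · have h := hFi.integral_prod_left.congr hae
    rw [integrable_indicator_iff measurableSet_Ioo, IntegrableOn,
      Measure.restrict_restrict measurableSet_Ioo, Set.inter_eq_left.2 hsub] at h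
    exact h
  · rw [← integral_indicator Metric.isOpen_ball.measurableSet,
      ← Complex.integral_comp_polarCoord_symm, polarCoord_target, Measure.volume_eq_prod,
      ← Measure.prod_restrict, integral_prod _ hFi, integral_congr_ae hae,
      setIntegral_indicator measurableSet_Ioo, Set.inter_eq_right.2 hsub]

/-- Jensen's formula for a linear factor: the circle average of `log ‖z - u‖` is `log (max s ‖u‖)`.
The sign, support and positivity of the kernel below all follow from this. -/
lemma circleAverage_log_sub_log {u : ℂ} (hu : u ≠ 0) {s : ℝ} (hs : 0 < s) :
    Real.circleAverage (fun z => Real.log ‖z - u‖ - Real.log ‖u‖) 0 s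
      = Real.log (max s ‖u‖) - Real.log ‖u‖ := by
  have hi : CircleIntegrable (fun z : ℂ => Real.log ‖z - u‖) 0 s :=
    MeromorphicOn.circleIntegrable_log_norm (fun _ _ ↦ by fun_prop)
  have h := Real.circleAverage_fun_sub hi (circleIntegrable_const (Real.log ‖u‖) 0 s)
  rw [h, Real.circleAverage_const,
    circleAverage_log_norm_sub_const_eq_log_radius_add_posLog hs.ne', zero_sub, norm_neg]
  congr 1
  have hu' : 0 < ‖u‖ := norm_pos_iff.2 hu
  rcases le_total s ‖u‖ with h | h
  · rw [max_eq_right h, Real.posLog_eq_log, Real.log_mul (by positivity) hu'.ne', Real.log_inv]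
    · ring
    · rw [abs_of_nonneg (by positivity), inv_mul_eq_div]
      exact (one_le_div hs).2 h
  · rw [max_eq_left h, add_eq_left, Real.posLog_eq_zero_iff, abs_of_nonneg (by positivity),
      inv_mul_eq_div]
    exact (div_le_one hs).2 h

/-- The excess over `log ‖u‖` of the integral of `log ‖· - u‖` over the disc of radius `ρ`. -/
noncomputable def logKernel (ρ : ℝ) (u : ℂ) : ℝ :=
  ∫ z in Metric.ball (0 : ℂ) ρ, (Real.log ‖z - u‖ - Real.log ‖u‖)

lemma logKernel_eq (ρ : ℝ) {u : ℂ} (hu : u ≠ 0) :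
    IntegrableOn (fun s => s * (2 * Real.pi * (Real.log (max s ‖u‖) - Real.log ‖u‖)))
      (Set.Ioo 0 ρ) ∧
    logKernel ρ u
      = ∫ s in Set.Ioo 0 ρ, s * (2 * Real.pi * (Real.log (max s ‖u‖) - Real.log ‖u‖)) := by
  have h := integral_ball_eq_integral_circleAverage (fun z => Real.log ‖z - u‖ - Real.log ‖u‖)
    (ρ := ρ) ((integrableOn_log_norm_sub u ρ).sub (integrableOn_const measure_ball_lt_top.ne))
    (by fun_prop)
  have hc : ∀ s ∈ Set.Ioo 0 ρ, s * (2 * Real.pi *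
      Real.circleAverage (fun z => Real.log ‖z - u‖ - Real.log ‖u‖) 0 s)
      = s * (2 * Real.pi * (Real.log (max s ‖u‖) - Real.log ‖u‖)) := fun s hs => by
    rw [circleAverage_log_sub_log hu hs.1]
  exact ⟨h.1.congr_fun hc measurableSet_Ioo, h.2.trans (setIntegral_congr_fun measurableSet_Ioo hc)⟩

lemma log_max_sub_log_nonneg {u : ℂ} (hu : u ≠ 0) (s : ℝ) :
    0 ≤ Real.log (max s ‖u‖) - Real.log ‖u‖ :=
  sub_nonneg.2 (Real.log_le_log (norm_pos_iff.2 hu) (le_max_right _ _))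

lemma logKernel_nonneg (ρ : ℝ) {u : ℂ} (hu : u ≠ 0) : 0 ≤ logKernel ρ u := by
  rw [(logKernel_eq ρ hu).2]
  refine setIntegral_nonneg measurableSet_Ioo fun s hs => ?_
  have := log_max_sub_log_nonneg hu s
  have := hs.1
  positivity

/-- This is the mean value property: `log ‖· - u‖` is harmonic on the open disc when `u` lies
outside it. -/
lemma logKernel_eq_zero {ρ : ℝ} (hρ : 0 < ρ) {u : ℂ} (hu : ρ ≤ ‖u‖) : logKernel ρ u = 0 := by
  rw [(logKernel_eq ρ (norm_pos_iff.1 (hρ.trans_le hu))).2]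
  refine setIntegral_eq_zero_of_forall_eq_zero fun s hs => ?_
  rw [max_eq_right (hs.2.le.trans hu)]
  simp

lemma logKernel_pos {ρ : ℝ} {u : ℂ} (hu : u ≠ 0) (hρ : ‖u‖ < ρ) : 0 < logKernel ρ u := by
  rw [(logKernel_eq ρ hu).2, setIntegral_pos_iff_support_of_nonneg_ae]
  · have hu' : 0 < ‖u‖ := norm_pos_iff.2 hu
    refine lt_of_lt_of_le ?_ (measure_mono (s := Set.Ioo ‖u‖ ρ) fun s hs => ?_)
    · simpa using hρ
    · have h0 : 0 < s := hu'.trans hs.1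
      refine ⟨?_, h0, hs.2⟩
      have : 0 < Real.log (max s ‖u‖) - Real.log ‖u‖ := by
        rw [max_eq_left hs.1.le]
        exact sub_pos.2 (Real.log_lt_log hu' hs.1)
      rw [Function.mem_support]
      positivity
  · refine (ae_restrict_iff' measurableSet_Ioo).2 (ae_of_all _ fun s hs => ?_)
    have := log_max_sub_log_nonneg hu s
    have := hs.1
    simp only [Pi.zero_apply]
    positivity
  · exact (logKernel_eq ρ hu).1

/-! ### Logarithmic potentials approximate test functions -/

lemma logKernel_eq_sub (ρ : ℝ) (u : ℂ) :
    logKernel ρ u = (∫ z in Metric.ball (0 : ℂ) ρ, Real.log ‖z - u‖)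
      - volume.real (Metric.ball (0 : ℂ) ρ) * Real.log ‖u‖ := by
  rw [logKernel, integral_sub (integrableOn_log_norm_sub u ρ)
    (integrableOn_const measure_ball_lt_top.ne), setIntegral_const, smul_eq_mul]

lemma measurable_integral_log_norm_sub (ρ : ℝ) :
    Measurable fun u : ℂ => ∫ z in Metric.ball (0 : ℂ) ρ, Real.log ‖z - u‖ := by
  refine (StronglyMeasurable.integral_prod_right ?_).measurable
  refine Measurable.stronglyMeasurable ?_
  simp only [Function.uncurry_def]
  fun_prop

lemma integrable_logKernel {ρ : ℝ} (hρ : 0 < ρ) : Integrable (logKernel ρ) := by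
  have hfin : volume (Metric.ball (0 : ℂ) ρ) ≠ ∞ := measure_ball_lt_top.ne
  obtain ⟨K, hK0, hK⟩ := exists_integral_log_sq_le ρ
  have hsupp : Function.support (logKernel ρ) ⊆ Metric.ball 0 ρ := by
    intro u hu
    by_contra h
    exact hu (logKernel_eq_zero hρ (by simpa using h))
  rw [← integrableOn_iff_integrable_of_support_subset hsupp]
  have h1 : IntegrableOn (fun u : ℂ => ∫ z in Metric.ball (0 : ℂ) ρ, Real.log ‖z - u‖)
      (Metric.ball 0 ρ) := by
    refine Integrable.mono' (integrableOn_const (C := K * (1 + ρ ^ 2)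
        + volume.real (Metric.ball (0 : ℂ) ρ)) hfin)
      (measurable_integral_log_norm_sub ρ).aestronglyMeasurable ?_
    refine (ae_restrict_iff' Metric.isOpen_ball.measurableSet).2 (ae_of_all _ fun u hu => ?_)
    have hu' : ‖u‖ < ρ := by simpa using hu
    refine (norm_integral_le_integral_norm _).trans ?_
    calc _ ≤ ∫ z in Metric.ball (0 : ℂ) ρ, (Real.log ‖z - u‖ ^ 2 + 1) := by
          refine integral_mono (integrableOn_log_norm_sub u ρ).norm
            ((hK u).1.add (integrableOn_const hfin)) fun z => ?_
          simp only [Real.norm_eq_abs]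
          nlinarith [sq_abs (Real.log ‖z - u‖), sq_nonneg (|Real.log ‖z - u‖| - 1 / 2)]
      _ = (∫ z in Metric.ball (0 : ℂ) ρ, Real.log ‖z - u‖ ^ 2)
            + volume.real (Metric.ball (0 : ℂ) ρ) := by
          rw [integral_add (hK u).1 (integrableOn_const hfin), setIntegral_const]
          simp
      _ ≤ _ := by
          gcongr
          refine (hK u).2.trans ?_
          gcongr
  refine (h1.sub ((integrableOn_log_norm_sub 0 ρ).const_mul
    (volume.real (Metric.ball (0 : ℂ) ρ)))).congr (ae_of_all _ fun u => ?_)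
  simp only [Pi.sub_apply, sub_zero]
  exact (logKernel_eq_sub ρ u).symm

/-- The convention `log 0 = 0` can spoil the sign at the origin, which is a null set. -/
lemma ae_logKernel_nonneg (ρ : ℝ) : ∀ᵐ u : ℂ, 0 ≤ logKernel ρ u := by
  filter_upwards [Measure.ae_ne volume (0 : ℂ)] with u hu using logKernel_nonneg ρ hu

lemma integral_logKernel_pos {ρ : ℝ} (hρ : 0 < ρ) : 0 < ∫ u, logKernel ρ u := by
  rw [integral_pos_iff_support_of_nonneg_ae (ae_logKernel_nonneg ρ) (integrable_logKernel hρ)]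
  have hsub : Metric.ball (0 : ℂ) ρ \ {0} ⊆ Function.support (logKernel ρ) := fun u hu =>
    (logKernel_pos (by simpa using hu.2) (by simpa using hu.1)).ne'
  refine lt_of_lt_of_le ?_ (measure_mono hsub)
  rw [measure_sdiff_null (measure_singleton _)]
  exact Metric.measure_ball_pos _ _ hρ

/-- Averaging `φ` over discs is dual to averaging the logarithm over discs. -/
lemma integral_mul_logKernel {φ : ℂ → ℝ} (hφ : Continuous φ) {B R ρ : ℝ}
    (hB : ∀ z, |φ z| ≤ B) (hR : ∀ z, R ≤ ‖z‖ → φ z = 0) (hρ : 0 < ρ) (w : ℂ) :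
    ∫ z, φ z * logKernel ρ (w - z)
      = ∫ z, ((∫ x in Metric.ball (0 : ℂ) ρ, φ (z - x))
          - volume.real (Metric.ball (0 : ℂ) ρ) * φ z) * Real.log ‖z - w‖ := by
  have hB0 : 0 ≤ B := (abs_nonneg _).trans (hB 0)
  -- For `‖x‖ < ρ` the factor `φ (z - x)` vanishes once `‖z‖ ≥ R + ρ`, so `B * L` dominates
  -- uniformly in `x`.
  set L : ℂ → ℝ := (Metric.ball (0 : ℂ) (R + ρ)).indicator fun z => |Real.log ‖z - w‖| with hL
  have hLi : Integrable L := (integrable_indicator_iff Metric.isOpen_ball.measurableSet).2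
    (integrableOn_log_norm_sub w _).abs
  have hdom : ∀ x ∈ Metric.ball (0 : ℂ) ρ, ∀ z,
      |φ (z - x) * Real.log ‖z - w‖| ≤ B * L z := by
    intro x hx z
    by_cases hz : ‖z‖ < R + ρ
    · rw [hL, Set.indicator_of_mem (by simpa using hz), abs_mul]
      gcongr
      exact hB _
    · have hx' : ‖x‖ < ρ := by simpa using hx
      have : R ≤ ‖z - x‖ := by linarith [norm_sub_norm_le z x]
      rw [hR _ this, hL, Set.indicator_of_notMem (by simpa using hz)]
      simp
  have hE : Integrable (fun p : ℂ × ℂ => φ (p.2 - p.1) * Real.log ‖p.2 - w‖)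
      ((volume.restrict (Metric.ball (0 : ℂ) ρ)).prod volume) := by
    refine Integrable.mono' (Integrable.mul_prod (f := fun _ => B) (g := L)
      (integrableOn_const measure_ball_lt_top.ne) hLi)
      (Measurable.aestronglyMeasurable (by fun_prop)) ?_
    have hmem : ∀ᵐ p : ℂ × ℂ ∂((volume.restrict (Metric.ball (0 : ℂ) ρ)).prod volume),
        p.1 ∈ Metric.ball (0 : ℂ) ρ :=
      Measure.quasiMeasurePreserving_fst.ae
        (ae_restrict_mem Metric.isOpen_ball.measurableSet)
    filter_upwards [hmem] with p hp using hdom p.1 hp p.2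
  have hE' : Integrable (fun p : ℂ × ℂ => φ p.2 * Real.log ‖p.1 + p.2 - w‖)
      ((volume.restrict (Metric.ball (0 : ℂ) ρ)).prod volume) := by
    -- The measure-preserving shear `(x, z) ↦ (x, z + x)` carries one integrand to the other.
    have h := (measurePreserving_prod_add_right (volume.restrict (Metric.ball (0 : ℂ) ρ))
      (volume : Measure ℂ)).integrable_comp_of_integrable hE
    refine h.congr (ae_of_all _ fun p => ?_)
    simp [add_comm]
  have hlog : Integrable fun z => φ z * Real.log ‖z - w‖ := by
    refine Integrable.mono' (hLi.const_mul B) (Measurable.aestronglyMeasurable (by fun_prop))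
      (ae_of_all _ fun z => ?_)
    simpa using hdom 0 (by simpa using hρ) z
  have h1 : ∀ z, φ z * logKernel ρ (w - z)
      = (∫ x in Metric.ball (0 : ℂ) ρ, φ z * Real.log ‖x + z - w‖)
        - volume.real (Metric.ball (0 : ℂ) ρ) * (φ z * Real.log ‖z - w‖) := by
    intro z
    rw [logKernel_eq_sub, integral_const_mul, norm_sub_rev w z]
    simp_rw [sub_sub_eq_add_sub]
    ring
  have h2 : ∀ z, ((∫ x in Metric.ball (0 : ℂ) ρ, φ (z - x))
          - volume.real (Metric.ball (0 : ℂ) ρ) * φ z) * Real.log ‖z - w‖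
      = (∫ x in Metric.ball (0 : ℂ) ρ, φ (z - x) * Real.log ‖z - w‖)
        - volume.real (Metric.ball (0 : ℂ) ρ) * (φ z * Real.log ‖z - w‖) := by
    intro z
    rw [integral_mul_const]
    ring
  simp_rw [h1, h2]
  rw [integral_sub hE'.integral_prod_right (hlog.const_mul _),
    integral_sub hE.integral_prod_right (hlog.const_mul _)]
  congr 1
  rw [← integral_integral_swap (f := fun x z => φ z * Real.log ‖x + z - w‖) hE',
    ← integral_integral_swap (f := fun x z => φ (z - x) * Real.log ‖z - w‖) hE]
  refine integral_congr_ae (ae_of_all _ fun x => ?_)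
  simp only
  rw [← integral_sub_right_eq_self (fun z => φ z * Real.log ‖x + z - w‖) x]
  simp

/-- A continuous compactly supported function is uniformly close to the logarithmic potential of
a bounded density supported in a disc. -/
lemma exists_potential_approx {φ : ℂ → ℝ} (hφ : Continuous φ) (hc : HasCompactSupport φ)
    {η : ℝ} (hη : 0 < η) :
    ∃ (R B : ℝ) (H : ℂ → ℝ), 0 < R ∧ 0 ≤ B ∧ Measurable H ∧ (∀ z, |H z| ≤ B) ∧
      ∀ w, |φ w - ∫ z in Metric.ball 0 R, H z * Real.log ‖z - w‖| ≤ η := by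
  obtain ⟨B, hB⟩ := hφ.bounded_above_of_compact_support hc
  simp only [Real.norm_eq_abs] at hB
  have hB0 : 0 ≤ B := (abs_nonneg _).trans (hB 0)
  obtain ⟨R, hR0, hR⟩ : ∃ R : ℝ, 0 < R ∧ ∀ z, R ≤ ‖z‖ → φ z = 0 := by
    obtain ⟨R, hR⟩ := hc.isCompact.isBounded.subset_ball 0
    refine ⟨max R 1, by positivity, fun z hz => ?_⟩
    by_contra h
    have := hR (subset_tsupport φ h)
    rw [mem_ball_zero_iff] at this
    exact absurd (this.trans_le (le_max_left R 1)) (not_lt.2 hz)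
  -- The radius is a modulus of uniform continuity: the kernel lives on a disc of radius `ρ`, where
  -- `φ` varies by less than `η`.
  obtain ⟨ρ, hρ, hunif⟩ :=
    Metric.uniformContinuous_iff.1 (hc.uniformContinuous_of_continuous hφ) η hη
  set V := volume.real (Metric.ball (0 : ℂ) ρ) with hV
  set c := ∫ u, logKernel ρ u with hcdef
  have hcpos : 0 < c := integral_logKernel_pos hρ
  have hV0 : 0 ≤ V := measureReal_nonneg
  -- A finite-scale substitute for the Laplacian of `φ`. By `integral_mul_logKernel` its potential
  -- is the convolution of `φ` with the kernel normalized to mass `1`.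
  set H : ℂ → ℝ := fun z => c⁻¹ * ((∫ x in Metric.ball (0 : ℂ) ρ, φ (z - x)) - V * φ z) with hH
  have hmean : ∀ z, |∫ x in Metric.ball (0 : ℂ) ρ, φ (z - x)| ≤ B * V := fun z => by
    rw [← Real.norm_eq_abs]
    exact norm_setIntegral_le_of_norm_le_const measure_ball_lt_top fun x _ => hB _
  have hHsupp : ∀ z, R + ρ ≤ ‖z‖ → H z = 0 := by
    intro z hz
    have h0 : ∫ x in Metric.ball (0 : ℂ) ρ, φ (z - x) = 0 := by
      refine setIntegral_eq_zero_of_forall_eq_zero fun x hx => hR _ ?_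
      have hx' : ‖x‖ < ρ := by simpa using hx
      linarith [norm_sub_norm_le z x]
    rw [hH]
    simp only
    rw [h0, hR z (by linarith)]
    simp
  have hHm : Measurable H := by
    have : Measurable fun z => ∫ x in Metric.ball (0 : ℂ) ρ, φ (z - x) := by
      refine (StronglyMeasurable.integral_prod_right ?_).measurable
      refine Measurable.stronglyMeasurable ?_
      simp only [Function.uncurry_def]
      fun_prop
    fun_prop
  refine ⟨R + ρ, c⁻¹ * (B * V + V * B), H, by positivity, by positivity, hHm, fun z => ?_,
    fun w => ?_⟩
  · rw [hH]
    simp only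
    rw [abs_mul, abs_of_pos (inv_pos.2 hcpos)]
    gcongr
    refine (abs_sub _ _).trans (add_le_add (hmean z) ?_)
    rw [abs_mul, abs_of_nonneg hV0]
    gcongr
    exact hB z
  · have hset : ∫ z in Metric.ball 0 (R + ρ), H z * Real.log ‖z - w‖
        = c⁻¹ * ∫ z, φ z * logKernel ρ (w - z) := by
      rw [setIntegral_eq_integral_of_forall_compl_eq_zero fun z hz => ?_,
        integral_mul_logKernel hφ hB hR hρ w, ← integral_const_mul]
      · refine integral_congr_ae (ae_of_all _ fun z => ?_)
        simp only [hH]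
        ring
      · rw [hHsupp z (by simpa using hz), zero_mul]
    have hki : Integrable fun z => logKernel ρ (w - z) := (integrable_logKernel hρ).comp_sub_left w
    have hkint : ∫ z, logKernel ρ (w - z) = c := integral_sub_left_eq_self _ _ w
    have hφk : Integrable fun z => φ z * logKernel ρ (w - z) :=
      hki.bdd_mul (c := B) hφ.aestronglyMeasurable (ae_of_all _ hB)
    have hk0 : ∀ᵐ z, 0 ≤ logKernel ρ (w - z) := by
      filter_upwards [Measure.ae_ne volume w] with z hz
      exact logKernel_nonneg ρ (sub_ne_zero.2 hz.symm)
    have hdiff : φ w - c⁻¹ * ∫ z, φ z * logKernel ρ (w - z)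
        = c⁻¹ * ∫ z, (φ w - φ z) * logKernel ρ (w - z) := by
      simp_rw [sub_mul]
      rw [integral_sub (hki.const_mul _) hφk, integral_const_mul, hkint]
      field_simp
    rw [hset, hdiff, abs_mul, abs_of_pos (inv_pos.2 hcpos)]
    have hle : |∫ z, (φ w - φ z) * logKernel ρ (w - z)| ≤ ∫ z, η * logKernel ρ (w - z) := by
      rw [← Real.norm_eq_abs]
      refine norm_integral_le_of_norm_le (hki.const_mul η) ?_
      filter_upwards [hk0] with z hz
      rw [Real.norm_eq_abs, abs_mul, abs_of_nonneg hz]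
      by_cases h : dist w z < ρ
      · gcongr
        exact (hunif h).le
      · rw [logKernel_eq_zero hρ (by simpa [dist_eq_norm] using h)]
        simp
    calc _ ≤ c⁻¹ * ∫ z, η * logKernel ρ (w - z) := by gcongr
      _ = η := by
        rw [integral_const_mul, hkint]
        field_simp

/-! ### Comparing point configurations through their logarithmic potentials -/

/-- The logarithmic potential of the normalized counting measure of a finite family of points. -/
noncomputable def potential {m : ℕ} (l : Fin m → ℂ) (z : ℂ) : ℝ :=
  (m : ℝ)⁻¹ * ∑ i, Real.log ‖z - l i‖

lemma measurable_potential {m : ℕ} (l : Fin m → ℂ) : Measurable (potential l) := by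
  unfold potential
  fun_prop

lemma integral_mul_potential {m : ℕ} (l : Fin m → ℂ) {H : ℂ → ℝ} {B : ℝ} (R : ℝ)
    (hH : Measurable H) (hB : ∀ z, |H z| ≤ B) :
    IntegrableOn (fun z => H z * potential l z) (Metric.ball 0 R) ∧
    ∫ z in Metric.ball 0 R, H z * potential l z
      = (m : ℝ)⁻¹ * ∑ i, ∫ z in Metric.ball 0 R, H z * Real.log ‖z - l i‖ := by
  have hi : ∀ i, IntegrableOn (fun z => H z * Real.log ‖z - l i‖) (Metric.ball 0 R) := fun i =>
    (integrableOn_log_norm_sub (l i) R).bdd_mul (c := B) hH.aestronglyMeasurable (ae_of_all _ hB)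
  have heq : (fun z => H z * potential l z)
      = fun z => (m : ℝ)⁻¹ * ∑ i, H z * Real.log ‖z - l i‖ := by
    ext z
    rw [potential, ← Finset.mul_sum]
    ring
  rw [heq]
  refine ⟨(integrable_finsetSum _ fun i _ => hi i).const_mul _, ?_⟩
  rw [integral_const_mul, integral_finsetSum _ fun i _ => hi i]

/-- Cauchy–Schwarz over the `m` points reduces the bound to single logarithms, whose `L²` norms grow
only quadratically in the point. -/
lemma integral_potential_sq_le {m : ℕ} (hm : 0 < m) (l : Fin m → ℂ) {R K C : ℝ} (hK0 : 0 ≤ K)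
    (hK : ∀ w : ℂ, IntegrableOn (fun z => Real.log ‖z - w‖ ^ 2) (Metric.ball 0 R) ∧
      ∫ z in Metric.ball 0 R, Real.log ‖z - w‖ ^ 2 ≤ K * (1 + ‖w‖ ^ 2))
    (hC : ∑ i, ‖l i‖ ^ 2 ≤ C * m) :
    IntegrableOn (fun z => potential l z ^ 2) (Metric.ball 0 R) ∧
    ∫ z in Metric.ball 0 R, potential l z ^ 2 ≤ K * (1 + C) := by
  have hm' : (0 : ℝ) < m := by exact_mod_cast hm
  have hle : ∀ z, potential l z ^ 2 ≤ (m : ℝ)⁻¹ * ∑ i, Real.log ‖z - l i‖ ^ 2 := by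
    intro z
    have h := sq_sum_le_card_mul_sum_sq (s := Finset.univ) (f := fun i => Real.log ‖z - l i‖)
    rw [Finset.card_univ, Fintype.card_fin] at h
    rw [potential, mul_pow]
    calc _ ≤ ((m : ℝ)⁻¹) ^ 2 * (m * ∑ i, Real.log ‖z - l i‖ ^ 2) := by gcongr
      _ = _ := by field_simp
  have hi : IntegrableOn (fun z => (m : ℝ)⁻¹ * ∑ i, Real.log ‖z - l i‖ ^ 2) (Metric.ball 0 R) :=
    (integrable_finsetSum _ fun i _ => (hK (l i)).1).const_mul _
  have hi' : IntegrableOn (fun z => potential l z ^ 2) (Metric.ball 0 R) := by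
    refine Integrable.mono' hi ((measurable_potential l).pow_const 2).aestronglyMeasurable
      (ae_of_all _ fun z => ?_)
    rw [Real.norm_of_nonneg (by positivity)]
    exact hle z
  refine ⟨hi', (integral_mono hi' hi hle).trans ?_⟩
  rw [integral_const_mul, integral_finsetSum _ fun i _ => (hK (l i)).1]
  calc _ ≤ (m : ℝ)⁻¹ * ∑ i, K * (1 + ‖l i‖ ^ 2) := by
        gcongr with i
        exact (hK (l i)).2
    _ = (m : ℝ)⁻¹ * (K * (m + ∑ i, ‖l i‖ ^ 2)) := by
        rw [← Finset.mul_sum, Finset.sum_add_distrib]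
        simp
    _ ≤ (m : ℝ)⁻¹ * (K * (m + C * m)) := by gcongr
    _ = K * (1 + C) := by field_simp

/-- An integral of `|F|` is small if `|F|` is mostly small and `∫ F ^ 2` is bounded. -/
lemma integral_abs_le_of_measure_le {F : ℂ → ℝ} (hF : Measurable F) {R D δ t η : ℝ}
    (hδ : 0 ≤ δ) (ht : 0 < t) (hη : 0 ≤ η)
    (hi : IntegrableOn (fun z => F z ^ 2) (Metric.ball 0 R))
    (hD : ∫ z in Metric.ball 0 R, F z ^ 2 ≤ D)
    (hS : volume (Metric.ball 0 R ∩ {z | δ < |F z|}) ≤ ENNReal.ofReal η) :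
    ∫ z in Metric.ball 0 R, |F z|
      ≤ δ * volume.real (Metric.ball (0 : ℂ) R) + t * D + t⁻¹ * η := by
  set S : Set ℂ := {z | δ < |F z|} with hSdef
  have hSm : MeasurableSet S := measurableSet_lt measurable_const hF.abs
  have hfin : volume (Metric.ball (0 : ℂ) R) ≠ ∞ := measure_ball_lt_top.ne
  have hiS : IntegrableOn (S.indicator fun _ => t⁻¹) (Metric.ball 0 R) :=
    (integrableOn_const (C := t⁻¹) hfin).indicator hSm
  have hle : ∀ z, |F z| ≤ δ + t * F z ^ 2 + S.indicator (fun _ => t⁻¹) z := by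
    intro z
    by_cases hz : z ∈ S
    · rw [Set.indicator_of_mem hz, ← sq_abs]
      -- Young's inequality, used only on the exceptional set; a small `t` tames the `L²` term at
      -- the price of `t⁻¹` times the small area.
      have h1 : |F z| ≤ t * |F z| ^ 2 + t⁻¹ := by
        have h2 : 0 ≤ t⁻¹ * (t * |F z| - 1 / 2) ^ 2 := by positivity
        have h3 : t⁻¹ * (t * |F z| - 1 / 2) ^ 2 = t * |F z| ^ 2 - |F z| + t⁻¹ / 4 := by
          field_simp
          ring
        have h4 : 0 < t⁻¹ := inv_pos.2 ht
        linarith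
      linarith
    · rw [Set.indicator_of_notMem hz]
      have h1 : |F z| ≤ δ := not_lt.1 hz
      have h2 : 0 ≤ t * F z ^ 2 := by positivity
      linarith
  have hconst : IntegrableOn (fun _ : ℂ => δ) (Metric.ball 0 R) := integrableOn_const hfin
  have hic : IntegrableOn (fun z => δ + t * F z ^ 2) (Metric.ball 0 R) :=
    hconst.add (hi.const_mul t)
  have hir := hic.add hiS
  have hil : IntegrableOn (fun z => |F z|) (Metric.ball 0 R) :=
    Integrable.mono' hir hF.abs.aestronglyMeasurable (ae_of_all _ fun z => by
      rw [Real.norm_eq_abs, abs_abs]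
      exact hle z)
  refine (integral_mono hil hir hle).trans ?_
  simp only [Pi.add_apply]
  rw [integral_add hic hiS, integral_add hconst (hi.const_mul t),
    setIntegral_const, smul_eq_mul, integral_const_mul, setIntegral_indicator hSm,
    setIntegral_const, smul_eq_mul, mul_comm δ, mul_comm t⁻¹ η]
  gcongr
  exact ENNReal.toReal_le_of_le_ofReal hη hS

/-- Two configurations with bounded second moments and close potentials have close averages of a
continuous compactly supported function. -/
lemma averages_close_of_hasCompactSupport {φ : ℂ → ℝ} (hφ : Continuous φ)
    (hc : HasCompactSupport φ) {C ε : ℝ} (hC : 0 ≤ C) (hε : 0 < ε) :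
    ∃ R δ η : ℝ, 0 < δ ∧ 0 < η ∧ ∀ (m : ℕ) (l l' : Fin m → ℂ), 0 < m →
      ∑ i, ‖l i‖ ^ 2 ≤ C * m → ∑ i, ‖l' i‖ ^ 2 ≤ C * m →
      volume (Metric.ball 0 R ∩ {z | δ < |potential l z - potential l' z|}) ≤ ENNReal.ofReal η →
      |(m : ℝ)⁻¹ * ∑ i, φ (l i) - (m : ℝ)⁻¹ * ∑ i, φ (l' i)| ≤ ε := by
  obtain ⟨R, B, H, -, hB0, hHm, hHB, hH⟩ := exists_potential_approx hφ hc (η := ε / 4)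
    (by positivity)
  obtain ⟨K, hK0, hK⟩ := exists_integral_log_sq_le R
  set V := volume.real (Metric.ball (0 : ℂ) R) with hV
  have hV0 : 0 ≤ V := measureReal_nonneg
  -- From `(a - b)² ≤ 2a² + 2b²`. Then `δ`, `t`, `η` make each of the three error terms, times `B`,
  -- at most `ε / 8`; the `+ 1`s avoid division by zero.
  set D := 4 * (K * (1 + C)) with hDdef
  have hD0 : 0 ≤ D := by positivity
  set δ := ε / (8 * (B + 1) * (V + 1)) with hδ
  set t := ε / (8 * (B + 1) * (D + 1)) with ht
  set η := ε * t / (8 * (B + 1)) with hη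
  have ht0 : 0 < t := by positivity
  have hδ0 : 0 < δ := by positivity
  have hη0 : 0 < η := by positivity
  refine ⟨R, δ, η, hδ0, hη0, fun m l l' hm hl hl' hvol => ?_⟩
  have hm' : (0 : ℝ) < m := by exact_mod_cast hm
  have happrox : ∀ k : Fin m → ℂ, |(m : ℝ)⁻¹ * ∑ i, φ (k i)
      - ∫ z in Metric.ball 0 R, H z * potential k z| ≤ ε / 4 := by
    intro k
    rw [(integral_mul_potential k R hHm hHB).2, ← mul_sub, ← Finset.sum_sub_distrib, abs_mul,
      abs_of_pos (inv_pos.2 hm')]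
    calc _ ≤ (m : ℝ)⁻¹ * ∑ _i : Fin m, ε / 4 := by
          gcongr
          exact (Finset.abs_sum_le_sum_abs _ _).trans (Finset.sum_le_sum fun i _ => hH _)
      _ = ε / 4 := by
          simp only [Finset.sum_const, Finset.card_univ, Fintype.card_fin, nsmul_eq_mul]
          field_simp
  set F : ℂ → ℝ := fun z => potential l z - potential l' z with hF
  have hFm : Measurable F := (measurable_potential l).sub (measurable_potential l')
  obtain ⟨hi1, hb1⟩ := integral_potential_sq_le hm l hK0 hK hl
  obtain ⟨hi2, hb2⟩ := integral_potential_sq_le hm l' hK0 hK hl'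
  have hFle : ∀ z, F z ^ 2 ≤ 2 * potential l z ^ 2 + 2 * potential l' z ^ 2 := fun z => by
    simp only [hF]
    nlinarith [sq_nonneg (potential l z + potential l' z)]
  have hisum := (hi1.const_mul 2).add (hi2.const_mul 2)
  have hFi : IntegrableOn (fun z => F z ^ 2) (Metric.ball 0 R) :=
    Integrable.mono' hisum (hFm.pow_const 2).aestronglyMeasurable (ae_of_all _ fun z => by
      rw [Real.norm_of_nonneg (by positivity)]
      exact hFle z)
  have hFD : ∫ z in Metric.ball 0 R, F z ^ 2 ≤ D := by
    refine (integral_mono hFi hisum hFle).trans ?_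
    simp only [Pi.add_apply]
    rw [integral_add (hi1.const_mul 2) (hi2.const_mul 2), integral_const_mul, integral_const_mul]
    linarith
  have habs := integral_abs_le_of_measure_le hFm hδ0.le ht0 hη0.le hFi hFD hvol
  have hHF : |(∫ z in Metric.ball 0 R, H z * potential l z)
      - ∫ z in Metric.ball 0 R, H z * potential l' z| ≤ B * ∫ z in Metric.ball 0 R, |F z| := by
    rw [← integral_sub (integral_mul_potential l R hHm hHB).1
      (integral_mul_potential l' R hHm hHB).1, ← integral_const_mul]
    have hFint : IntegrableOn F (Metric.ball 0 R) := by
      have h1 := (integral_mul_potential l R (H := fun _ => 1) (B := 1) measurable_const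
        (by simp)).1
      have h2 := (integral_mul_potential l' R (H := fun _ => 1) (B := 1) measurable_const
        (by simp)).1
      simp only [one_mul] at h1 h2
      exact h1.sub h2
    rw [← Real.norm_eq_abs]
    refine norm_integral_le_of_norm_le (hFint.abs.const_mul B) (ae_of_all _ fun z => ?_)
    rw [← mul_sub, Real.norm_eq_abs, abs_mul]
    gcongr
    exact hHB z
  have e1 : B * (δ * V) ≤ ε / 8 := by
    rw [hδ]
    rw [show B * (ε / (8 * (B + 1) * (V + 1)) * V) = ε / 8 * ((B / (B + 1)) * (V / (V + 1))) by
      field_simp]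
    refine mul_le_of_le_one_right (by positivity) (mul_le_one₀ ?_ (by positivity) ?_) <;>
    · rw [div_le_one (by positivity)]; linarith
  have e2 : B * (t * D) ≤ ε / 8 := by
    rw [ht]
    rw [show B * (ε / (8 * (B + 1) * (D + 1)) * D) = ε / 8 * ((B / (B + 1)) * (D / (D + 1))) by
      field_simp]
    refine mul_le_of_le_one_right (by positivity) (mul_le_one₀ ?_ (by positivity) ?_) <;>
    · rw [div_le_one (by positivity)]; linarith
  have e3 : B * (t⁻¹ * η) ≤ ε / 8 := by
    rw [hη]
    rw [show B * (t⁻¹ * (ε * t / (8 * (B + 1)))) = ε / 8 * (B / (B + 1)) by field_simp]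
    refine mul_le_of_le_one_right (by positivity) ?_
    rw [div_le_one (by positivity)]; linarith
  have e4 : B * ∫ z in Metric.ball 0 R, |F z| ≤ B * (δ * V + t * D + t⁻¹ * η) := by gcongr
  have e5 : B * (δ * V + t * D + t⁻¹ * η) = B * (δ * V) + B * (t * D) + B * (t⁻¹ * η) := by ring
  have e6 : B * ∫ z in Metric.ball 0 R, |F z| ≤ ε / 8 + ε / 8 + ε / 8 := by linarith
  have h1 := abs_le.1 (happrox l)
  have h2 := abs_le.1 (happrox l')
  have h3 := abs_le.1 (hHF.trans e6)
  rw [abs_le]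
  constructor <;> linarith [h1.1, h1.2, h2.1, h2.2, h3.1, h3.2]

/-- The continuous cutoff equal to `1` on the disc of radius `r` and to `0` off that of radius
`r + 1`. -/
noncomputable def cutoff (r : ℝ) (z : ℂ) : ℝ := max 0 (min 1 (r + 1 - ‖z‖))

lemma hasCompactSupport_mul_cutoff (φ : ℂ → ℝ) (r : ℝ) :
    HasCompactSupport fun z => φ z * cutoff r z := by
  refine HasCompactSupport.intro (isCompact_closedBall (0 : ℂ) (r + 1)) fun z hz => ?_
  have hz' : r + 1 < ‖z‖ := by simpa using hz
  rw [cutoff, max_eq_left ((min_le_right _ _).trans (by linarith)), mul_zero]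

/-- Two configurations with bounded second moments and close potentials have close averages of a
bounded continuous function. -/
lemma averages_close (φ : ℂ →ᵇ ℝ) {C ε : ℝ} (hC : 0 ≤ C) (hε : 0 < ε) :
    ∃ R δ η : ℝ, 0 < δ ∧ 0 < η ∧ ∀ (m : ℕ) (l l' : Fin m → ℂ), 0 < m →
      ∑ i, ‖l i‖ ^ 2 ≤ C * m → ∑ i, ‖l' i‖ ^ 2 ≤ C * m →
      volume (Metric.ball 0 R ∩ {z | δ < |potential l z - potential l' z|}) ≤ ENNReal.ofReal η →
      |(m : ℝ)⁻¹ * ∑ i, φ (l i) - (m : ℝ)⁻¹ * ∑ i, φ (l' i)| ≤ ε := by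
  -- Chebyshev: beyond radius `r ≥ 1` one has `1 ≤ ‖z‖² / r`, so cutting off costs at most `‖φ‖ C /
  -- r ≤ ε / 4` per configuration.
  set r : ℝ := 1 + 4 * ‖φ‖ * C / ε with hr
  have hr1 : 1 ≤ r := by
    have : 0 ≤ 4 * ‖φ‖ * C / ε := by positivity
    linarith
  have hcont : Continuous fun z => φ z * cutoff r z := by
    unfold cutoff
    fun_prop
  obtain ⟨R, δ, η, hδ, hη, h⟩ := averages_close_of_hasCompactSupport hcont
    (hasCompactSupport_mul_cutoff φ r) hC (ε := ε / 2) (by positivity)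
  refine ⟨R, δ, η, hδ, hη, fun m l l' hm hl hl' hvol => ?_⟩
  have hm' : (0 : ℝ) < m := by exact_mod_cast hm
  have htail : ∀ z, |φ z - φ z * cutoff r z| ≤ ‖φ‖ / r * ‖z‖ ^ 2 := by
    intro z
    have hc0 : 0 ≤ cutoff r z := le_max_left _ _
    have hc1 : cutoff r z ≤ 1 := max_le zero_le_one (min_le_left _ _)
    by_cases hz : ‖z‖ ≤ r
    · have : cutoff r z = 1 := by
        rw [cutoff, min_eq_left (by linarith), max_eq_right zero_le_one]
      rw [this, mul_one, sub_self, abs_zero]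
      positivity
    · push Not at hz
      have h1 : |φ z - φ z * cutoff r z| ≤ ‖φ‖ := by
        rw [show φ z - φ z * cutoff r z = φ z * (1 - cutoff r z) by ring, abs_mul,
          abs_of_nonneg (sub_nonneg.2 hc1)]
        calc _ ≤ ‖φ‖ * 1 := mul_le_mul (φ.norm_coe_le_norm z) (by linarith) (by linarith)
              (norm_nonneg _)
          _ = ‖φ‖ := mul_one _
      refine h1.trans ?_
      rw [div_mul_eq_mul_div, le_div_iff₀ (by linarith)]
      gcongr
      nlinarith
  have happrox : ∀ k : Fin m → ℂ, ∑ i, ‖k i‖ ^ 2 ≤ C * m →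
      |(m : ℝ)⁻¹ * ∑ i, φ (k i) - (m : ℝ)⁻¹ * ∑ i, φ (k i) * cutoff r (k i)| ≤ ε / 4 := by
    intro k hk
    rw [← mul_sub, ← Finset.sum_sub_distrib, abs_mul, abs_of_pos (inv_pos.2 hm')]
    calc _ ≤ (m : ℝ)⁻¹ * ∑ i, ‖φ‖ / r * ‖k i‖ ^ 2 := by
          gcongr
          exact (Finset.abs_sum_le_sum_abs _ _).trans (Finset.sum_le_sum fun i _ => htail _)
      _ = (m : ℝ)⁻¹ * (‖φ‖ / r * ∑ i, ‖k i‖ ^ 2) := by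
          rw [← Finset.mul_sum]
      _ ≤ (m : ℝ)⁻¹ * (‖φ‖ / r * (C * m)) := by gcongr
      _ = ‖φ‖ * C / r := by field_simp
      _ ≤ ε / 4 := by
          rw [div_le_iff₀ (by linarith), hr]
          have : ε / 4 * (1 + 4 * ‖φ‖ * C / ε) = ε / 4 + ‖φ‖ * C := by field_simp
          linarith
  have h1 := abs_le.1 (happrox l hl)
  have h2 := abs_le.1 (happrox l' hl')
  have h3 := abs_le.1 (h m l l' hm hl hl' hvol)
  rw [abs_le]
  constructor <;> linarith [h1.1, h1.2, h2.1, h2.2, h3.1, h3.2]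

/-! ### Schur's inequality -/

lemma re_trace_mul_conjTranspose {m : ℕ} (A : Matrix (Fin m) (Fin m) ℂ) :
    (A * Aᴴ).trace.re = ∑ i, ∑ j, ‖A i j‖ ^ 2 := by
  simp only [Matrix.trace, Matrix.diag_apply, Matrix.mul_apply, Matrix.conjTranspose_apply,
    Complex.re_sum]
  refine Finset.sum_congr rfl fun i _ => Finset.sum_congr rfl fun j _ => ?_
  rw [Complex.star_def, Complex.mul_conj, Complex.ofReal_re, Complex.normSq_eq_norm_sq]

lemma frobeniusNorm_sq {m : ℕ} (A : Matrix (Fin m) (Fin m) ℂ) :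
    frobeniusNorm A ^ 2 = ∑ i, ∑ j, ‖A i j‖ ^ 2 := by
  rw [frobeniusNorm, re_trace_mul_conjTranspose, Real.sq_sqrt (by positivity)]

lemma charpoly_succ_of_col_zero {R : Type*} [CommRing R] {n : ℕ}
    (B : Matrix (Fin (n + 1)) (Fin (n + 1)) R) (hB : ∀ i, i ≠ 0 → B i 0 = 0) :
    B.charpoly = (Polynomial.X - Polynomial.C (B 0 0))
      * (B.submatrix Fin.succ Fin.succ).charpoly := by
  rw [Matrix.charpoly, Matrix.det_succ_column_zero, Finset.sum_eq_single 0]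
  · rw [Matrix.charmatrix_apply_eq, Matrix.charpoly]
    simp only [Fin.val_zero, pow_zero, one_mul, Fin.succAbove_zero]
    congr 2
    ext i j : 1
    by_cases h : i = j
    · subst h
      simp [Matrix.charmatrix_apply_eq]
    · simp [Matrix.charmatrix_apply_ne _ _ _ h,
        Matrix.charmatrix_apply_ne _ _ _ (fun h' => h (Fin.succ_injective _ h'))]
  · intro i _ hi
    rw [Matrix.charmatrix_apply_ne _ _ _ hi, hB i hi]
    simp
  · simp

/-- One step of Schur triangularization: a unit eigenvector is completed to an orthonormal basis,
whose vectors are the columns of `U`. -/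
lemma exists_unitary_conj_col_zero {n : ℕ} (A : Matrix (Fin (n + 1)) (Fin (n + 1)) ℂ) :
    ∃ U ∈ Matrix.unitaryGroup (Fin (n + 1)) ℂ, ∀ i, i ≠ 0 → (Uᴴ * A * U) i 0 = 0 := by
  obtain ⟨c, hc⟩ := Module.End.exists_eigenvalue (Matrix.toEuclideanLin A)
  obtain ⟨v, hv⟩ := hc.exists_hasEigenvector
  have hv0 : ‖v‖ ≠ 0 := norm_ne_zero_iff.2 hv.2
  set e : EuclideanSpace ℂ (Fin (n + 1)) := ((‖v‖ : ℂ)⁻¹) • v with he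
  have hnorm : ‖e‖ = 1 := by
    rw [he, norm_smul, norm_inv, Complex.norm_real, norm_norm, inv_mul_cancel₀ hv0]
  have hAe : Matrix.toEuclideanLin A e = c • e := by
    rw [he, map_smul, hv.apply_eq_smul, smul_comm]
  have hon : Orthonormal ℂ (({0} : Set (Fin (n + 1))).domRestrict fun _ => e) :=
    ⟨fun _ => hnorm, fun i j hij => absurd (Subsingleton.elim i j) hij⟩
  obtain ⟨b, hb⟩ := hon.exists_orthonormalBasis_extension_of_card_eq (by simp)
  have hb0 : b 0 = e := hb 0 rfl
  set U := (EuclideanSpace.basisFun (Fin (n + 1)) ℂ).toBasis.toMatrix b with hU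
  have hUmem : U ∈ Matrix.unitaryGroup (Fin (n + 1)) ℂ :=
    OrthonormalBasis.toMatrix_orthonormalBasis_mem_unitary _ _
  have hUapp : ∀ i j, U i j = b j i := fun i j => by
    simp [hU, Module.Basis.toMatrix_apply]
  refine ⟨U, hUmem, fun i hi => ?_⟩
  have hcol : ∀ k, (A * U) k 0 = c * U k 0 := by
    intro k
    have h := congrArg (fun x : EuclideanSpace ℂ (Fin (n + 1)) => x k) hAe
    simp only [Matrix.toLpLin_apply, PiLp.smul_apply, smul_eq_mul] at h
    rw [hUapp, hb0, ← h, Matrix.mul_apply]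
    simp only [hUapp, hb0]
    rfl
  rw [Matrix.mul_assoc, Matrix.mul_apply]
  simp_rw [hcol]
  have hone : (Uᴴ * U) i 0 = 0 := by
    rw [← Matrix.star_eq_conjTranspose, (Matrix.mem_unitaryGroup_iff').1 hUmem,
      Matrix.one_apply_ne hi]
  rw [Matrix.mul_apply] at hone
  calc _ = c * ∑ j, Uᴴ i j * U j 0 := by
        rw [Finset.mul_sum]
        exact Finset.sum_congr rfl fun j _ => by ring
    _ = 0 := by rw [hone, mul_zero]

/-- Schur's inequality by deflation: unitary conjugation preserves both sides, one eigenvalue then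
sits in the corner, and induction handles the remaining block. The rest of the first row is
discarded. -/
lemma sum_norm_sq_roots_charpoly_le {m : ℕ} (A : Matrix (Fin m) (Fin m) ℂ) :
    (A.charpoly.roots.map fun z => ‖z‖ ^ 2).sum ≤ ∑ i, ∑ j, ‖A i j‖ ^ 2 := by
  induction m with
  | zero => simp
  | succ n ih =>
    obtain ⟨U, hU, hcol⟩ := exists_unitary_conj_col_zero A
    have h1 : Uᴴ * U = 1 := (Matrix.mem_unitaryGroup_iff').1 hU
    have h2 : U * Uᴴ = 1 := (Matrix.mem_unitaryGroup_iff).1 hU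
    set B := Uᴴ * A * U with hB
    have hchar : B.charpoly = A.charpoly := by
      rw [hB, Matrix.charpoly_mul_comm, ← Matrix.mul_assoc, h2, Matrix.one_mul]
    have hfrob : ∑ i, ∑ j, ‖B i j‖ ^ 2 = ∑ i, ∑ j, ‖A i j‖ ^ 2 := by
      rw [← re_trace_mul_conjTranspose, ← re_trace_mul_conjTranspose]
      have : B * Bᴴ = Uᴴ * (A * Aᴴ * U) := by
        rw [hB]
        simp only [Matrix.conjTranspose_mul, Matrix.conjTranspose_conjTranspose, Matrix.mul_assoc]
        rw [← Matrix.mul_assoc U Uᴴ, h2, Matrix.one_mul]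
      rw [this, Matrix.trace_mul_comm, Matrix.mul_assoc, h2, Matrix.mul_one]
    rw [← hfrob, ← hchar, charpoly_succ_of_col_zero B hcol,
      Polynomial.roots_mul (mul_ne_zero (Polynomial.X_sub_C_ne_zero _)
        (Matrix.charpoly_monic _).ne_zero), Polynomial.roots_X_sub_C, Multiset.map_add,
      Multiset.sum_add, Multiset.map_singleton, Multiset.sum_singleton, Fin.sum_univ_succ]
    refine add_le_add ?_ ((ih _).trans ?_)
    · exact Finset.single_le_sum (f := fun j => ‖B 0 j‖ ^ 2) (fun j _ => by positivity)
        (Finset.mem_univ 0)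
    · refine Finset.sum_le_sum fun i _ => ?_
      rw [Fin.sum_univ_succ]
      simp only [Matrix.submatrix_apply]
      have : 0 ≤ ‖B i.succ 0‖ ^ 2 := by positivity
      linarith

/-! ### Eigenvalues, empirical spectral measures and determinants -/

lemma exists_eigenvalues {m : ℕ} (A : Matrix (Fin m) (Fin m) ℂ) :
    ∃ l : Fin m → ℂ, A.charpoly.roots = Multiset.map l Finset.univ.val := by
  have hcard : A.charpoly.roots.toList.length = m := by
    rw [Multiset.length_toList, IsAlgClosed.card_roots_eq_natDegree,
      Matrix.charpoly_natDegree_eq_dim, Fintype.card_fin]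
  refine ⟨fun i => A.charpoly.roots.toList.get (i.cast hcard.symm), ?_⟩
  rw [Fin.univ_val_map]
  conv_lhs => rw [← Multiset.coe_toList A.charpoly.roots]
  congr 1
  refine List.ext_get (by simp [hcard]) fun n h1 h2 => ?_
  simp

/-- The eigenvalues of a complex matrix, with algebraic multiplicity. -/
noncomputable def eigs {m : ℕ} (A : Matrix (Fin m) (Fin m) ℂ) : Fin m → ℂ :=
  (exists_eigenvalues A).choose

lemma roots_charpoly_eq_eigs {m : ℕ} (A : Matrix (Fin m) (Fin m) ℂ) :
    A.charpoly.roots = Multiset.map (eigs A) Finset.univ.val :=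
  (exists_eigenvalues A).choose_spec

lemma sum_norm_sq_eigs_le {m : ℕ} (A : Matrix (Fin m) (Fin m) ℂ) :
    ∑ i, ‖eigs A i‖ ^ 2 ≤ frobeniusNorm A ^ 2 := by
  rw [frobeniusNorm_sq]
  refine le_trans (le_of_eq ?_) (sum_norm_sq_roots_charpoly_le A)
  rw [roots_charpoly_eq_eigs, Multiset.map_map]
  rfl

lemma integral_esm {m : ℕ} (A : Matrix (Fin m) (Fin m) ℂ) (φ : ℂ →ᵇ ℝ) :
    ∫ w, φ w ∂(esm A) = (m : ℝ)⁻¹ * ∑ i, φ (eigs A i) := by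
  have h : esm A = (m : ℝ≥0∞)⁻¹ • ∑ i, Measure.dirac (eigs A i) := by
    rw [esm, roots_charpoly_eq_eigs, Multiset.map_map]
    rfl
  rw [h, integral_smul_measure, integral_finsetSum_measure fun i _ => φ.integrable _]
  simp

lemma norm_det_sub_smul {m : ℕ} (A : Matrix (Fin m) (Fin m) ℂ) (z : ℂ) :
    ‖(A - z • (1 : Matrix (Fin m) (Fin m) ℂ)).det‖ = ∏ i, ‖z - eigs A i‖ := by
  have h1 : ‖(A - z • (1 : Matrix (Fin m) (Fin m) ℂ)).det‖ = ‖A.charpoly.eval z‖ := by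
    rw [Matrix.eval_charpoly, ← neg_sub, Matrix.det_neg, norm_mul, norm_pow, norm_neg, norm_one,
      one_pow, one_mul, Matrix.scalar_apply, Matrix.smul_one_eq_diagonal]
  rw [h1]
  conv_lhs => rw [(IsAlgClosed.splits A.charpoly).eq_prod_roots_of_monic (Matrix.charpoly_monic A)]
  rw [roots_charpoly_eq_eigs, Multiset.map_map, Polynomial.eval_multiset_prod, Multiset.map_map]
  change ‖∏ i, _‖ = _
  rw [norm_prod]
  simp

/-- The normalized log-determinant difference of two shifted matrices. -/
noncomputable def logDetDiff {m : ℕ} (A B : Matrix (Fin m) (Fin m) ℂ) (z : ℂ) : ℝ :=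
  (m : ℝ)⁻¹ * Real.log ‖(A - z • (1 : Matrix (Fin m) (Fin m) ℂ)).det‖
    - (m : ℝ)⁻¹ * Real.log ‖(B - z • (1 : Matrix (Fin m) (Fin m) ℂ)).det‖

/-- Eigenvalues must be avoided: since `Real.log 0 = 0`, the logarithm of a vanishing product need
not be the sum of the logarithms. -/
lemma log_det_eq_potential {m : ℕ} (A : Matrix (Fin m) (Fin m) ℂ) {z : ℂ}
    (hz : ∀ i, z ≠ eigs A i) :
    (m : ℝ)⁻¹ * Real.log ‖(A - z • (1 : Matrix (Fin m) (Fin m) ℂ)).det‖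
      = potential (eigs A) z := by
  rw [norm_det_sub_smul, potential,
    Real.log_prod fun i _ => norm_ne_zero_iff.2 (sub_ne_zero.2 (hz i))]

lemma ae_logDetDiff_eq {m : ℕ} (A B : Matrix (Fin m) (Fin m) ℂ) :
    ∀ᵐ z : ℂ, logDetDiff A B z = potential (eigs A) z - potential (eigs B) z := by
  have h : ∀ l : Fin m → ℂ, ∀ᵐ z : ℂ, ∀ i, z ≠ l i := fun l =>
    ae_all_iff.2 fun i => Measure.ae_ne volume (l i)
  filter_upwards [h (eigs A), h (eigs B)] with z hA hB
  rw [logDetDiff, log_det_eq_potential A hA, log_det_eq_potential B hB]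

/-- Deterministic replacement principle: if two matrices have bounded normalized Frobenius norms
and close normalized log-determinants off a small set of shifts, then their empirical spectral
measures are close. -/
lemma integral_esm_close (φ : ℂ →ᵇ ℝ) {C ε : ℝ} (hC : 0 ≤ C) (hε : 0 < ε) :
    ∃ R δ η : ℝ, 0 < δ ∧ 0 < η ∧ ∀ (m : ℕ) (A B : Matrix (Fin m) (Fin m) ℂ), 0 < m →
      1 / (m : ℝ) * frobeniusNorm A ^ 2 + 1 / (m : ℝ) * frobeniusNorm B ^ 2 ≤ C →
      volume (Metric.ball 0 R ∩ {z | δ < |logDetDiff A B z|}) ≤ ENNReal.ofReal η →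
      |∫ w, φ w ∂(esm A) - ∫ w, φ w ∂(esm B)| ≤ ε := by
  obtain ⟨R, δ, η, hδ, hη, h⟩ := averages_close φ hC hε
  refine ⟨R, δ, η, hδ, hη, fun m A B hm hfr hvol => ?_⟩
  have hm' : (0 : ℝ) < m := by exact_mod_cast hm
  rw [integral_esm, integral_esm]
  have hA : 0 ≤ 1 / (m : ℝ) * frobeniusNorm A ^ 2 := by positivity
  have hB : 0 ≤ 1 / (m : ℝ) * frobeniusNorm B ^ 2 := by positivity
  have key : ∀ D : Matrix (Fin m) (Fin m) ℂ, 1 / (m : ℝ) * frobeniusNorm D ^ 2 ≤ C →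
      ∑ i, ‖eigs D i‖ ^ 2 ≤ C * m := fun D hD => by
    refine (sum_norm_sq_eigs_le D).trans ?_
    rwa [one_div, inv_mul_le_iff₀ hm', mul_comm] at hD
  refine h m _ _ hm (key A (by linarith)) (key B (by linarith)) (le_trans (le_of_eq ?_) hvol)
  refine measure_congr ?_
  filter_upwards [ae_logDetDiff_eq A B] with z hz
  refine propext ?_
  change (_ ∧ δ < |_|) ↔ (_ ∧ δ < |_|)
  rw [hz]

/-! ### Perturbation of the log-determinant -/

lemma norm_eigs_le_opNorm {m : ℕ} (A : Matrix (Fin m) (Fin m) ℂ) (i : Fin m) :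
    ‖eigs A i‖ ≤ opNorm A := by
  have hroot : A.charpoly.IsRoot (eigs A i) := by
    refine Polynomial.isRoot_of_mem_roots ?_
    rw [roots_charpoly_eq_eigs]
    exact Multiset.mem_map_of_mem _ (Finset.mem_univ i)
  have hspec := Matrix.mem_spectrum_iff_isRoot_charpoly.2 hroot
  rw [← AlgEquiv.spectrum_eq (Matrix.toEuclideanCLM (n := Fin m) (𝕜 := ℂ)) A] at hspec
  refine (spectrum.norm_le_norm_mul_of_mem hspec).trans ?_
  exact mul_le_of_le_one_right (norm_nonneg _) ContinuousLinearMap.norm_id_le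

lemma opNorm_nonneg {m : ℕ} (A : Matrix (Fin m) (Fin m) ℂ) : 0 ≤ opNorm A := norm_nonneg _

lemma opNorm_mul_le {m : ℕ} (A B : Matrix (Fin m) (Fin m) ℂ) :
    opNorm (A * B) ≤ opNorm A * opNorm B := by
  rw [opNorm, map_mul]
  exact norm_mul_le _ _

lemma abs_log_norm_one_add_le {w : ℂ} {η : ℝ} (hη : η ≤ 1 / 2) (hw : ‖w‖ ≤ η) :
    |Real.log ‖-1 - w‖| ≤ 2 * η := by
  have hη0 : 0 ≤ η := (norm_nonneg w).trans hw
  have h1 : ‖-1 - w‖ ≤ 1 + η := by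
    refine (norm_sub_le _ _).trans ?_
    rw [norm_neg, norm_one]
    linarith
  have h2 : 1 - η ≤ ‖-1 - w‖ := by
    have := norm_sub_norm_le (-1 : ℂ) w
    rw [norm_neg, norm_one] at this
    linarith
  have hpos : 0 < ‖-1 - w‖ := by linarith
  rw [abs_le]
  constructor
  · have h3 := Real.one_sub_inv_le_log_of_pos hpos
    have h4 : ‖-1 - w‖⁻¹ ≤ 1 + 2 * η := by
      rw [inv_le_iff_one_le_mul₀ hpos]
      nlinarith
    linarith
  · have h3 := Real.log_le_sub_one_of_pos hpos
    linarith

lemma abs_logDetDiff_add_le {m : ℕ} {A P : Matrix (Fin m) (Fin m) ℂ} {z : ℂ} {c η : ℝ}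
    (hres : ResolventBound A z c) (hη : η ≤ 1 / 2) (hP : c * opNorm P ≤ η) :
    |logDetDiff A (A + P) z| ≤ 2 * η := by
  obtain ⟨hu, hle⟩ := hres
  set S := A - z • (1 : Matrix (Fin m) (Fin m) ℂ) with hS
  have hdet : IsUnit S.det := (Matrix.isUnit_iff_isUnit_det S).1 hu
  set E := S⁻¹ * P with hE
  have hEle : opNorm E ≤ η :=
    (opNorm_mul_le _ _).trans ((mul_le_mul_of_nonneg_right hle (opNorm_nonneg P)).trans hP)
  have hη0 : 0 ≤ η := (opNorm_nonneg E).trans hEle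
  -- The factor `1 + E` is written as `E - (-1)I` so that `norm_det_sub_smul` applies at the shift
  -- `-1`.
  have hfac : A + P - z • (1 : Matrix (Fin m) (Fin m) ℂ)
      = S * (E - (-1 : ℂ) • (1 : Matrix (Fin m) (Fin m) ℂ)) := by
    rw [Matrix.mul_sub, hE, Matrix.mul_nonsing_inv_cancel_left _ _ hdet]
    simp only [neg_smul, one_smul, Matrix.mul_neg, Matrix.mul_one, sub_neg_eq_add, hS]
    abel
  have hEi : ∀ i, ‖eigs E i‖ ≤ η := fun i => (norm_eigs_le_opNorm E i).trans hEle
  have hne : ∀ i, ‖-1 - eigs E i‖ ≠ 0 := fun i => by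
    have := norm_sub_norm_le (-1 : ℂ) (eigs E i)
    rw [norm_neg, norm_one] at this
    linarith [hEi i]
  have hlog : Real.log ‖(A + P - z • (1 : Matrix (Fin m) (Fin m) ℂ)).det‖
      = Real.log ‖S.det‖ + ∑ i, Real.log ‖-1 - eigs E i‖ := by
    rw [hfac, Matrix.det_mul, norm_mul, norm_det_sub_smul E,
      Real.log_mul (norm_ne_zero_iff.2 hdet.ne_zero) (Finset.prod_ne_zero_iff.2 fun i _ => hne i),
      Real.log_prod fun i _ => hne i]
  rw [logDetDiff, hlog, ← hS, ← mul_sub, sub_add_cancel_left, abs_mul, abs_neg,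
    abs_of_nonneg (by positivity : (0 : ℝ) ≤ (m : ℝ)⁻¹)]
  calc _ ≤ (m : ℝ)⁻¹ * ∑ _i : Fin m, 2 * η := by
        gcongr
        exact (Finset.abs_sum_le_sum_abs _ _).trans
          (Finset.sum_le_sum fun i _ => abs_log_norm_one_add_le hη (hEi i))
    _ ≤ 2 * η := by
        simp only [Finset.sum_const, Finset.card_univ, Fintype.card_fin, nsmul_eq_mul]
        rw [← mul_assoc]
        exact mul_le_of_le_one_left (by positivity) inv_mul_le_one

/-! ### Measurability -/

section Measurability

variable {X : Type*} [MeasurableSpace X] {m : ℕ}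

lemma measurable_det {A : X → Matrix (Fin m) (Fin m) ℂ}
    (hA : ∀ i j, Measurable fun x => A x i j) : Measurable fun x => (A x).det := by
  simp only [Matrix.det_apply']
  exact Finset.measurable_fun_sum _ fun σ _ =>
    (Finset.measurable_fun_prod _ fun i _ => hA _ _).const_mul _

lemma measurable_sub_smul_one {A : X → Matrix (Fin m) (Fin m) ℂ} {z : X → ℂ}
    (hA : ∀ i j, Measurable fun x => A x i j) (hz : Measurable z) (i j : Fin m) :
    Measurable fun x => (A x - z x • (1 : Matrix (Fin m) (Fin m) ℂ)) i j := by
  simp only [Matrix.sub_apply, Matrix.smul_apply, smul_eq_mul]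
  exact (hA i j).sub (hz.mul_const _)

/-- Letting the shift vary with `x` gives joint measurability in `(z, ω)`, as the Fubini arguments
require. -/
lemma measurable_logDetDiff {A B : X → Matrix (Fin m) (Fin m) ℂ} {z : X → ℂ}
    (hA : ∀ i j, Measurable fun x => A x i j) (hB : ∀ i j, Measurable fun x => B x i j)
    (hz : Measurable z) : Measurable fun x => logDetDiff (A x) (B x) (z x) := by
  have h1 := measurable_det (measurable_sub_smul_one hA hz)
  have h2 := measurable_det (measurable_sub_smul_one hB hz)
  unfold logDetDiff
  fun_prop

lemma measurable_frobeniusNorm {A : X → Matrix (Fin m) (Fin m) ℂ}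
    (hA : ∀ i j, Measurable fun x => A x i j) : Measurable fun x => frobeniusNorm (A x) := by
  simp only [frobeniusNorm, re_trace_mul_conjTranspose]
  fun_prop

lemma measurable_opNorm {A : X → Matrix (Fin m) (Fin m) ℂ}
    (hA : ∀ i j, Measurable fun x => A x i j) : Measurable fun x => opNorm (A x) := by
  let T : (Fin m → Fin m → ℂ) →ₗ[ℂ]
      (EuclideanSpace ℂ (Fin m) →L[ℂ] EuclideanSpace ℂ (Fin m)) :=
    (Matrix.toEuclideanCLM (n := Fin m) (𝕜 := ℂ)).toAlgEquiv.toLinearMap ∘ₗ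
      (Matrix.ofLinearEquiv ℂ).toLinearMap
  have hT : Continuous fun a : Fin m → Fin m → ℂ => ‖T a‖ :=
    T.continuous_of_finiteDimensional.norm
  have hA' : Measurable fun x => (fun i j => A x i j : Fin m → Fin m → ℂ) :=
    measurable_pi_lambda _ fun i => measurable_pi_lambda _ fun j => hA i j
  exact hT.measurable.comp hA'

lemma measurable_inv {A : X → Matrix (Fin m) (Fin m) ℂ}
    (hA : ∀ i j, Measurable fun x => A x i j) (i j : Fin m) :
    Measurable fun x => (A x)⁻¹ i j := by
  simp only [Matrix.inv_def, Matrix.smul_apply, Ring.inverse_eq_inv', smul_eq_mul,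
    Matrix.adjugate_apply]
  refine (measurable_det hA).inv.mul (measurable_det fun k l => ?_)
  by_cases h : k = j
  · subst h
    simp
  · simpa [Matrix.updateRow_ne h] using hA k l

lemma measurableSet_resolventBound {A : X → Matrix (Fin m) (Fin m) ℂ}
    (hA : ∀ i j, Measurable fun x => A x i j) (z : ℂ) (c : ℝ) :
    MeasurableSet {x | ResolventBound (A x) z c} := by
  have h := measurable_sub_smul_one hA (measurable_const (a := z))
  simp only [ResolventBound, Matrix.isUnit_iff_isUnit_det, isUnit_iff_ne_zero]
  exact (measurable_det h (measurableSet_singleton 0).compl).inter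
    (measurableSet_le (measurable_opNorm (measurable_inv h)) measurable_const)

end Measurability

/-! ### Probabilistic arguments -/

section Probability

variable {Ω : Type*} [MeasurableSpace Ω] {Pr : Measure Ω} [IsProbabilityMeasure Pr]

lemma tendsto_measure_compl_zero {s : ℕ → Set Ω} (hs : ∀ n, MeasurableSet (s n))
    (h : Tendsto (fun n => Pr (s n)) atTop (𝓝 1)) :
    Tendsto (fun n => Pr (s n)ᶜ) atTop (𝓝 0) := by
  simp_rw [prob_compl_eq_one_sub (hs _)]
  simpa using ENNReal.Tendsto.sub (tendsto_const_nhds (x := (1 : ℝ≥0∞))) h (Or.inl (by simp))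

/-- If `L n (z, ·) → 0` in probability for almost every `z`, then the area of the set of `z` in a
disc where `L n` is not small tends to zero in probability. -/
lemma tendsto_measure_volume_gt {L : ℕ → ℂ × Ω → ℝ} (hL : ∀ n, Measurable (L n)) {δ : ℝ}
    (h : ∀ᵐ z : ℂ, Tendsto (fun n => Pr {ω | δ < |L n (z, ω)|}) atTop (𝓝 0))
    (R : ℝ) {η : ℝ} (hη : 0 < η) :
    Tendsto (fun n => Pr {ω | ENNReal.ofReal η ≤
      volume (Metric.ball 0 R ∩ {z | δ < |L n (z, ω)|})}) atTop (𝓝 0) := by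
  set ν : Measure ℂ := volume.restrict (Metric.ball 0 R) with hν
  set S : ℕ → Set (ℂ × Ω) := fun n => {p | δ < |L n p|} with hS
  have hSm : ∀ n, MeasurableSet (S n) := fun n => measurableSet_lt measurable_const (hL n).abs
  have hvol : ∀ n ω, volume (Metric.ball 0 R ∩ {z | δ < |L n (z, ω)|})
      = ν ((fun z => (z, ω)) ⁻¹' S n) := fun n ω => by
    rw [hν, Measure.restrict_apply (measurable_prodMk_right (hSm n)), Set.inter_comm]
    rfl
  simp_rw [hvol]
  -- Dominated convergence on the disc makes the expected area of the bad set tend to zero; Tonelli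
  -- and Markov's inequality then finish.
  have hint : Tendsto (fun n => ∫⁻ z, Pr (Prod.mk z ⁻¹' S n) ∂ν) atTop (𝓝 0) := by
    have := tendsto_lintegral_of_dominated_convergence (μ := ν)
      (F := fun n z => Pr (Prod.mk z ⁻¹' S n)) (f := fun _ => 0) (fun _ => 1)
      (fun n => measurable_measure_prodMk_left (hSm n)) (fun n => ae_of_all _ fun z => prob_le_one)
      (by simpa [hν] using (measure_ball_lt_top (μ := volume) (x := (0 : ℂ)) (r := R)).ne) (ae_restrict_of_ae h)
    simpa using this
  have hη' : ENNReal.ofReal η ≠ 0 := by simpa using hη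
  refine tendsto_of_tendsto_of_tendsto_of_le_of_le tendsto_const_nhds
    (h := fun n => (∫⁻ z, Pr (Prod.mk z ⁻¹' S n) ∂ν) / ENNReal.ofReal η) ?_ (fun _ => zero_le)
    (fun n => ?_)
  · simpa using ENNReal.Tendsto.div_const hint (Or.inr hη')
  · have h1 := meas_ge_le_lintegral_div (μ := Pr)
      (measurable_measure_prodMk_right (μ := ν) (hSm n)).aemeasurable hη' ENNReal.ofReal_ne_top
    rwa [← Measure.prod_apply_symm (hSm n), Measure.prod_apply (hSm n)] at h1

lemma BoundedInProbability.exists_eventually_le {X : ℕ → Ω → ℝ}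
    (hX : BoundedInProbability Pr X) (hm : ∀ n, Measurable (X n)) {ε : ℝ≥0∞} (hε : 0 < ε) :
    ∃ C : ℝ, 0 ≤ C ∧ ∀ᶠ n in atTop, Pr {ω | C < |X n ω|} ≤ ε := by
  have hlt : 1 - ε < 1 := ENNReal.sub_lt_self (by simp) (by simp) hε.ne'
  obtain ⟨C, hC, hC0⟩ := ((hX.eventually_const_lt hlt).and (eventually_ge_atTop 0)).exists
  refine ⟨C, hC0, ?_⟩
  filter_upwards [eventually_lt_of_lt_liminf hC] with n hn
  have hset : {ω | C < |X n ω|} = {ω | |X n ω| ≤ C}ᶜ := by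
    ext ω
    simp
  rw [hset, prob_compl_eq_one_sub (measurableSet_le (hm n).abs measurable_const)]
  rw [tsub_le_iff_left]
  exact tsub_le_iff_right.1 hn.le

lemma exists_eventually_abs_le_of_limsup_lt_top {x : ℕ → ℝ}
    (h : limsup (fun n => ENNReal.ofReal |x n|) atTop < ∞) :
    ∃ C : ℝ, 0 ≤ C ∧ ∀ᶠ n in atTop, |x n| ≤ C := by
  obtain ⟨c, hc, hctop⟩ := exists_between h
  refine ⟨c.toReal, ENNReal.toReal_nonneg, ?_⟩
  filter_upwards [eventually_lt_of_limsup_lt hc] with n hn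
  exact (ENNReal.ofReal_le_iff_le_toReal hctop.ne).1 hn.le

/-- The replacement principle in probability, for log-determinants. -/
lemma diffTendstoZeroInProbability_of_logDetDiff
    {A B : (m : ℕ) → Ω → Matrix (Fin m) (Fin m) ℂ}
    (hA : ∀ m i j, Measurable fun ω => A m ω i j) (hB : ∀ m i j, Measurable fun ω => B m ω i j)
    (hbdd : BoundedInProbability Pr fun m ω => 1 / (m : ℝ) * frobeniusNorm (A m ω) ^ 2
      + 1 / (m : ℝ) * frobeniusNorm (B m ω) ^ 2)
    (hlog : ∀ᵐ z : ℂ, ∀ δ : ℝ, 0 < δ →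
      Tendsto (fun m => Pr {ω | δ < |logDetDiff (A m ω) (B m ω) z|}) atTop (𝓝 0)) :
    DiffTendstoZeroInProbability Pr (fun m ω => esm (A m ω)) (fun m ω => esm (B m ω)) := by
  intro φ
  rw [tendstoInMeasure_iff_norm]
  intro ε hε
  rw [ENNReal.tendsto_nhds_zero]
  intro ε' hε'
  have hX : ∀ m : ℕ, Measurable fun ω => 1 / (m : ℝ) * frobeniusNorm (A m ω) ^ 2
      + 1 / (m : ℝ) * frobeniusNorm (B m ω) ^ 2 := fun m =>
    (((measurable_frobeniusNorm (hA m)).pow_const 2).const_mul _).add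
      (((measurable_frobeniusNorm (hB m)).pow_const 2).const_mul _)
  obtain ⟨C, hC, hCev⟩ := hbdd.exists_eventually_le hX (ENNReal.half_pos hε'.ne')
  obtain ⟨R, δ, η, hδ, hη, hclose⟩ := integral_esm_close φ hC (half_pos hε)
  have hvol := tendsto_measure_volume_gt (Pr := Pr)
    (L := fun m p => logDetDiff (A m p.2) (B m p.2) p.1) (fun m =>
      measurable_logDetDiff (fun i j => (hA m i j).comp measurable_snd)
        (fun i j => (hB m i j).comp measurable_snd) measurable_fst)
    (hlog.mono fun z hz => hz δ hδ) R hη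
  filter_upwards [hCev, (ENNReal.tendsto_nhds_zero.1 hvol) _ (ENNReal.half_pos hε'.ne'),
    eventually_gt_atTop 0] with m h1 h2 hm
  rw [← ENNReal.add_halves ε']
  refine le_trans (measure_mono fun ω hω => ?_) ((measure_union_le _ _).trans (add_le_add h1 h2))
  by_contra hcon
  rw [Set.mem_union, not_or] at hcon
  have hb : |_| ≤ C := not_lt.1 hcon.1
  have hv : volume (Metric.ball 0 R ∩ {z | δ < |logDetDiff (A m ω) (B m ω) z|})
      ≤ ENNReal.ofReal η := (not_le.1 hcon.2).le
  have h3 := hclose m (A m ω) (B m ω) hm ((le_abs_self _).trans hb) hv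
  have h4 : ε ≤ |∫ w, φ w ∂(esm (A m ω)) - ∫ w, φ w ∂(esm (B m ω))| := by
    simpa using hω
  linarith

/-- The replacement principle for a deterministic sequence of matrices. -/
lemma tendsto_integral_esm_sub {A B : (m : ℕ) → Matrix (Fin m) (Fin m) ℂ} (φ : ℂ →ᵇ ℝ)
    (hbdd : limsup (fun m : ℕ => ENNReal.ofReal |1 / (m : ℝ) * frobeniusNorm (A m) ^ 2
      + 1 / (m : ℝ) * frobeniusNorm (B m) ^ 2|) atTop < ∞)
    (hlog : ∀ᵐ z : ℂ, Tendsto (fun m => logDetDiff (A m) (B m) z) atTop (𝓝 0)) :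
    Tendsto (fun m => (∫ w, φ w ∂(esm (A m))) - ∫ w, φ w ∂(esm (B m))) atTop (𝓝 0) := by
  obtain ⟨C, hC, hCev⟩ := exists_eventually_abs_le_of_limsup_lt_top hbdd
  rw [Metric.tendsto_atTop']
  intro ε hε
  obtain ⟨R, δ, η, hδ, hη, hclose⟩ := integral_esm_close φ hC (half_pos hε)
  have : IsFiniteMeasure (volume.restrict (Metric.ball (0 : ℂ) R)) :=
    ⟨by simpa using measure_ball_lt_top (μ := volume) (x := (0 : ℂ)) (r := R)⟩
  have hm : ∀ m, Measurable fun z => logDetDiff (A m) (B m) z := fun m =>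
    measurable_logDetDiff (fun _ _ => measurable_const) (fun _ _ => measurable_const) measurable_id
  -- On the disc, of finite area, almost everywhere convergence implies convergence in measure,
  -- which controls the bad area.
  have hmeas := tendstoInMeasure_iff_norm.1 (tendstoInMeasure_of_tendsto_ae
    (μ := volume.restrict (Metric.ball (0 : ℂ) R))
    (fun m => (hm m).aestronglyMeasurable) (ae_restrict_of_ae hlog)) δ hδ
  have hev := (ENNReal.tendsto_nhds_zero.1 hmeas) (ENNReal.ofReal η) (by simpa using hη)
  obtain ⟨N, hN⟩ := eventually_atTop.1 ((hCev.and hev).and (eventually_gt_atTop 0))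
  refine ⟨N, fun m hmN => ?_⟩
  obtain ⟨⟨h1, h2⟩, h3⟩ := hN m hmN.le
  rw [Real.dist_eq, sub_zero]
  refine lt_of_le_of_lt (hclose m (A m) (B m) h3 ((le_abs_self _).trans h1) ?_)
    (half_lt_self hε)
  refine le_trans ?_ h2
  rw [Measure.restrict_apply' Metric.isOpen_ball.measurableSet, Set.inter_comm]
  refine measure_mono (Set.inter_subset_inter_left _ fun z hz' => ?_)
  have hz' : δ < |logDetDiff (A m) (B m) z| := hz'
  simpa using hz'.le

/-- The almost sure replacement principle, for log-determinants. -/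
lemma diffTendstoZeroAlmostSurely_of_logDetDiff
    {A B : (m : ℕ) → Ω → Matrix (Fin m) (Fin m) ℂ}
    (hA : ∀ m i j, Measurable fun ω => A m ω i j) (hB : ∀ m i j, Measurable fun ω => B m ω i j)
    (hbdd : AlmostSurelyBounded Pr fun m ω => 1 / (m : ℝ) * frobeniusNorm (A m ω) ^ 2
      + 1 / (m : ℝ) * frobeniusNorm (B m ω) ^ 2)
    (hlog : ∀ᵐ z : ℂ, ∀ᵐ ω ∂Pr,
      Tendsto (fun m => logDetDiff (A m ω) (B m ω) z) atTop (𝓝 0)) :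
    DiffTendstoZeroAlmostSurely Pr (fun m ω => esm (A m ω)) (fun m ω => esm (B m ω)) := by
  intro φ
  have hL : ∀ m, Measurable fun p : ℂ × Ω => logDetDiff (A m p.2) (B m p.2) p.1 := fun m =>
    measurable_logDetDiff (fun i j => (hA m i j).comp measurable_snd)
      (fun i j => (hB m i j).comp measurable_snd) measurable_fst
  have hset : MeasurableSet {p : ℂ × Ω |
      Tendsto (fun m => logDetDiff (A m p.2) (B m p.2) p.1) atTop (𝓝 0)} :=
    measurableSet_tendsto (𝓝 0) hL
  have hswap : ∀ᵐ ω ∂Pr, ∀ᵐ z : ℂ,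
      Tendsto (fun m => logDetDiff (A m ω) (B m ω) z) atTop (𝓝 0) :=
    (Measure.ae_ae_comm hset).1 hlog
  filter_upwards [hbdd, hswap] with ω hω hz
  exact tendsto_integral_esm_sub φ hω hz

end Probability

end ReplacementPrinciple

/-! ### The replacement principle under a resolvent bound -/

open ReplacementPrinciple in
theorem corollary3p3 {Ω : Type*} [MeasurableSpace Ω] (Pr : Measure Ω) [IsProbabilityMeasure Pr]
    (M P : (m : ℕ) → Ω → Matrix (Fin m) (Fin m) ℂ)
    (hM : ∀ m i j, Measurable fun ω => M m ω i j)
    (hP : ∀ m i j, Measurable fun ω => P m ω i j)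
    (f : ℂ → ℕ → ℝ) (hf : ∀ z m, 1 ≤ f z m) :
    -- in probability
    (BoundedInProbability Pr
        (fun m ω => 1 / (m : ℝ) * frobeniusNorm (M m ω) ^ 2
          + 1 / (m : ℝ) * frobeniusNorm (M m ω + P m ω) ^ 2) →
      (∀ᵐ z : ℂ, TendstoInMeasure Pr (fun m ω => f z m * opNorm (P m ω)) atTop (fun _ => 0)) →
      (∀ᵐ z : ℂ, Tendsto (fun m => Pr {ω | ResolventBound (M m ω) z (f z m)}) atTop (𝓝 1)) →
      DiffTendstoZeroInProbability Pr (fun m ω => esm (M m ω))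
        (fun m ω => esm (M m ω + P m ω))) ∧
    -- almost surely
    (AlmostSurelyBounded Pr
        (fun m ω => 1 / (m : ℝ) * frobeniusNorm (M m ω) ^ 2
          + 1 / (m : ℝ) * frobeniusNorm (M m ω + P m ω) ^ 2) →
      (∀ᵐ z : ℂ, ∀ᵐ ω ∂Pr, Tendsto (fun m => f z m * opNorm (P m ω)) atTop (𝓝 0)) →
      (∀ᵐ z : ℂ, ∀ᵐ ω ∂Pr, ∀ᶠ m in atTop, ResolventBound (M m ω) z (f z m)) →
      DiffTendstoZeroAlmostSurely Pr (fun m ω => esm (M m ω))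
        (fun m ω => esm (M m ω + P m ω))) := by
  have hMP : ∀ m i j, Measurable fun ω => (M m ω + P m ω) i j := fun m i j =>
    (hM m i j).add (hP m i j)
  refine ⟨fun hbdd hPz hRes => ?_, fun hbdd hPz hRes => ?_⟩
  · refine diffTendstoZeroInProbability_of_logDetDiff hM hMP hbdd ?_
    filter_upwards [hPz, hRes] with z h1 h2 δ hδ
    -- The cap `1 / 2` keeps the eigenvalues of `1 + E` away from `0`; `δ / 2` offsets the factor
    -- `2` in the perturbation bound.
    set η : ℝ := min (1 / 2) (δ / 2) with hη
    have hη0 : 0 < η := lt_min (by norm_num) (half_pos hδ)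
    have hP0 := tendstoInMeasure_iff_norm.1 h1 η hη0
    have hR0 := tendsto_measure_compl_zero
      (fun m => measurableSet_resolventBound (hM m) z (f z m)) h2
    have hsum := hP0.add hR0
    rw [add_zero] at hsum
    refine tendsto_of_tendsto_of_tendsto_of_le_of_le tendsto_const_nhds hsum
      (fun _ => zero_le) fun m => ?_
    refine (measure_mono fun ω hω => ?_).trans (measure_union_le _ _)
    by_contra hcon
    rw [Set.mem_union, not_or] at hcon
    have hres : ResolventBound (M m ω) z (f z m) := not_not.1 hcon.2
    have hsmall : ‖f z m * opNorm (P m ω) - 0‖ < η := not_le.1 hcon.1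
    rw [sub_zero, Real.norm_eq_abs] at hsmall
    have h3 := abs_logDetDiff_add_le hres (min_le_left _ _) ((le_abs_self _).trans hsmall.le)
    have h4 : δ < |logDetDiff (M m ω) (M m ω + P m ω) z| := hω
    have h5 : η ≤ δ / 2 := min_le_right _ _
    linarith
  · refine diffTendstoZeroAlmostSurely_of_logDetDiff hM hMP hbdd ?_
    filter_upwards [hPz, hRes] with z h1 h2
    filter_upwards [h1, h2] with ω hω1 hω2
    refine squeeze_zero_norm' (a := fun m => 2 * (f z m * opNorm (P m ω))) ?_
      (by simpa using hω1.const_mul 2)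
    filter_upwards [hω2, hω1.eventually_le_const (by norm_num : (0 : ℝ) < 1 / 2)] with m hres hle
    exact abs_logDetDiff_add_le hres hle le_rfl
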